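/- Consider the dispersionless focusing NLS system $$u_t+v\,u_x+u\,v_x=0,\qquad v_t-u_x+v\,v_x=0 \qquad (1)$$ for real functions $u(x,t),v(x,t)$, the hodograph equations $$x=v\,t+f_u(u,v),\qquad 0=u\,t+f_v(u,v) \qquad (2)$$ and the linear PDE $$f_{vv}+u\,f_{uu}=0. \qquad (3)$$ (i) Let $a\le b$ (the case $a=b$ is allowed) and let $u_I,v_I$ be real-valued functions, real analytic at every point of $[a,b]$, such that on $[a,b]$ one has $u_I>0$ and $(u_I')^2+(v_I')^2\neq 0$, and the curve $x\mapsto(u_I(x),v_I(x))$ is injective. Then there are an open set $\Omega\subset\{(u,v):u>0\}$, a real analytic solution $f$ of (3) on $\Omega$, a number $\delta>0$, and real analytic functions $u,v$ on the rectangle $R_\delta=\{a-\delta<x<b+\delta,\ |t|<\delta\}$ that solve (1) on $R_\delta$ with $u(x,0)=u_I(x)$, $v(x,0)=v_I(x)$ for $a-\delta<x<b+\delta$, and such that for every $(x,t)\in R_\delta$ the pair $(u(x,t),v(x,t))$ is the unique solution in $\Omega$ of (2). This is the solution of the Cauchy problem: any real analytic solution of (1) on a rectangle $R_{\delta'}$,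 $\delta'>0$, with the same initial values for $a-\delta'<x<b+\delta'$ coincides with $(u,v)$ on $R_{\min(\delta,\delta')}$. (Every point $x_0$ where $u_I,v_I$ are analytic with $u_I>0$ and $(u_I')^2+(v_I')^2\ne0$ is covered, by $a=b=x_0$.) (ii) Conversely, let $f$ be a $C^2$ solution of (3) on an open set $\Omega\subset\mathbb R^2$, and let $(\tilde u,\tilde v)\in\Omega$ with $\tilde u\ge 0$, $f_v(\tilde u,\tilde v)=0$ and $u^2f_{uu}^2+f_{uv}^2\neq0$ at $(\tilde u,\tilde v)$. Put $\tilde x=f_u(\tilde u,\tilde v)$. Then there are an open neighbourhood $N\subset\Omega$ of $(\tilde u,\tilde v)$ and $\delta>0$ such that for every $(x,t)$ with $|x-\tilde x|<\delta$, $|t|<\delta$ the equations (2) have exactly one solution $(u(x,t),v(x,t))$ in $N$; the functions $u,v$ so defined are $C^1$, solve (1), and satisfy $u(\tilde x,0)=\tilde u$, $v(\tilde x,0)=\tilde v$. If $f$ is real analytic on $\Omega$, then so are $u$ and $v$ on that square. -/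

import Mathlib

open Set

namespace DispersionlessNLS

/-- Partial derivative of `g : ℝ × ℝ → ℝ` in its first variable. -/
noncomputable def pd₁ (g : ℝ × ℝ → ℝ) (p : ℝ × ℝ) : ℝ :=
  deriv (fun s : ℝ => g (s, p.2)) p.1

/-- Partial derivative of `g : ℝ × ℝ → ℝ` in its second variable. -/
noncomputable def pd₂ (g : ℝ × ℝ → ℝ) (p : ℝ × ℝ) : ℝ :=
  deriv (fun s : ℝ => g (p.1, s)) p.2

/-- `(u, v)`, functions of `p = (x, t)`, is a classical (continuously differentiable) solution on
the open set `W` of the dispersionless focusing NLS system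
`u_t + v u_x + u v_x = 0`, `v_t - u_x + v v_x = 0`. -/
structure IsSolution (u v : ℝ × ℝ → ℝ) (W : Set (ℝ × ℝ)) : Prop where
  contDiffOn_u : ContDiffOn ℝ 1 u W
  contDiffOn_v : ContDiffOn ℝ 1 v W
  eq_u : ∀ p ∈ W, pd₂ u p + v p * pd₁ u p + u p * pd₁ v p = 0
  eq_v : ∀ p ∈ W, pd₂ v p - pd₁ u p + v p * pd₁ v p = 0

/-- `f`, a function of `q = (u, v)`, satisfies `f_vv + u f_uu = 0` at every point of `Ω`
(to be used for `f` of class `C²` on the open set `Ω`). -/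
def SolvesLinearPDE (f : ℝ × ℝ → ℝ) (Ω : Set (ℝ × ℝ)) : Prop :=
  ∀ q ∈ Ω, pd₂ (pd₂ f) q + q.1 * pd₁ (pd₁ f) q = 0

/-- The hodograph equations `x = v t + f_u(u, v)`, `0 = u t + f_v(u, v)`
at `p = (x, t)`, `q = (u, v)`. -/
def HodographEq (f : ℝ × ℝ → ℝ) (p q : ℝ × ℝ) : Prop :=
  p.1 = q.2 * p.2 + pd₁ f q ∧ 0 = q.1 * p.2 + pd₂ f q

/-- For each `(x, t) ∈ W`, the pair `(u (x, t), v (x, t))` is the one and only solution in `Ω` of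
the hodograph equations. -/
def DeterminedByHodograph (f : ℝ × ℝ → ℝ) (Ω : Set (ℝ × ℝ)) (u v : ℝ × ℝ → ℝ)
    (W : Set (ℝ × ℝ)) : Prop :=
  ∀ p ∈ W, (u p, v p) ∈ Ω ∧ ∀ q ∈ Ω, HodographEq f p q ↔ q = (u p, v p)

/-- The open rectangle `a - δ < x < b + δ`, `|t| < δ` in the `(x, t)`-plane. -/
def box (a b δ : ℝ) : Set (ℝ × ℝ) := Ioo (a - δ) (b + δ) ×ˢ Ioo (-δ) δ

end DispersionlessNLS

/-!
The hodograph transformation exchanges the roles of `(x, t)` and `(u, v)`. Both directions rest on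
the Jacobian determinants: `u_x² + u v_x²` for a solution of the system (`IsSolution.jacobian_eq`),
and `-(u f_uu² + (t + f_uv)²)` for the hodograph equations.

From the system to the hodograph equations (`exists_hodograph_potential`): where the first
determinant does not vanish and `(x, t) ↦ (u, v)` is injective, `x` and `t` are functions of
`(u, v)`. The one-form `x du - t d(uv)` is closed by the first equation of the system, hence has a
potential `f` with `f_u = x - v t`, `f_v = -u t`; these are the hodograph equations, and the second
equation of the system says `f_vv + u f_uu = 0`. The potential is analytic because its derivative is
(`analyticAt_of_hasFDerivAt`).

Existence for the Cauchy problem (`cauchy_local`) is a case of the Cauchy–Kovalevskaya theorem,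
proved by power series. In `u = ∑ uₙ(x) tⁿ`, `v = ∑ vₙ(x) tⁿ` the coefficients are given by a
quadratic recursion involving `d/dx` (`timeCoeff`). If `u₀` and `v₀` are majorized by
`C / (1 - A x)`, then `uₙ` and `vₙ` are majorized by `C Lⁿ cₙ / (1 - A x)^(2n+1)` with `cₙ` the
Catalan numbers (`isMajorizedBy_timeCoeff`), so that all coefficients are geometrically bounded and
the double series is jointly analytic (`analyticAt_tsum_evalAt`). The `uₙ` and `vₙ` are globally
defined functions of `x`, so no gluing is needed along `[a, b]`, and compactness provides both a
common rectangle and injectivity there (`exists_cauchy_solution`). Uniqueness (`cauchy_unique`)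
follows by showing that the difference of two solutions vanishes to infinite order on `t = 0`.

From the hodograph equations to the system (`exists_solution_of_hodograph`): as the second
determinant does not vanish, the inverse function theorem solves the hodograph equations with the
regularity of `f_u` and `f_v`, and differentiating them yields the system
(`isSolution_of_hodographEq`).
-/

namespace DispersionlessNLS

section PowerSeriesInTime

open PowerSeries Filter Topology
open scoped ContDiff

/-! ### Evaluation of real power series -/

/-- The power series `φ` converges absolutely at every real point of absolute value `< ρ`. -/
def ConvergesOn (ρ : ℝ) (φ : ℝ⟦X⟧) : Prop :=
  ∀ h : ℝ, |h| < ρ → Summable fun n => ‖coeff n φ * h ^ n‖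

/-- The sum of the power series `φ` at the real number `h` (meaningful where it converges). -/
noncomputable def evalAt (h : ℝ) (φ : ℝ⟦X⟧) : ℝ := ∑' n, coeff n φ * h ^ n

namespace ConvergesOn

variable {ρ : ℝ} {φ ψ : ℝ⟦X⟧}

theorem hasSum (hφ : ConvergesOn ρ φ) {h : ℝ} (hh : |h| < ρ) :
    HasSum (fun n => coeff n φ * h ^ n) (evalAt h φ) :=
  (hφ h hh).of_norm.hasSum

theorem of_bound {C A : ℝ} (hA : 0 < A) (hφ : ∀ n, |coeff n φ| ≤ C * A ^ n) :
    ConvergesOn A⁻¹ φ := by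
  intro h hh
  have h1 : A * |h| < 1 := by
    have := mul_lt_mul_of_pos_left hh hA
    rwa [mul_inv_cancel₀ hA.ne'] at this
  have h2 : Summable fun n => C * (A * |h|) ^ n :=
    (summable_geometric_of_lt_one (by positivity) h1).mul_left C
  refine h2.of_nonneg_of_le (fun n => norm_nonneg _) fun n => ?_
  rw [norm_mul, norm_pow, Real.norm_eq_abs, Real.norm_eq_abs, mul_pow, ← mul_assoc]
  exact mul_le_mul_of_nonneg_right (hφ n) (by positivity)

theorem add (hφ : ConvergesOn ρ φ) (hψ : ConvergesOn ρ ψ) : ConvergesOn ρ (φ + ψ) := by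
  intro h hh
  refine ((hφ h hh).add (hψ h hh)).of_nonneg_of_le (fun n => norm_nonneg _) fun n => ?_
  rw [map_add, add_mul]
  exact norm_add_le _ _

theorem smul (hφ : ConvergesOn ρ φ) (c : ℝ) : ConvergesOn ρ (c • φ) := by
  intro h hh
  refine ((hφ h hh).mul_left ‖c‖).congr fun n => ?_
  rw [← norm_mul, PowerSeries.coeff_smul, smul_eq_mul, mul_assoc]

theorem neg (hφ : ConvergesOn ρ φ) : ConvergesOn ρ (-φ) := by
  simpa using hφ.smul (-1)

theorem sub (hφ : ConvergesOn ρ φ) (hψ : ConvergesOn ρ ψ) : ConvergesOn ρ (φ - ψ) := by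
  rw [sub_eq_add_neg]
  exact hφ.add hψ.neg

theorem sum {ι : Type*} (s : Finset ι) {F : ι → ℝ⟦X⟧} (hF : ∀ i ∈ s, ConvergesOn ρ (F i)) :
    ConvergesOn ρ (∑ i ∈ s, F i) := by
  classical
  induction s using Finset.induction_on with
  | empty => intro h _; simp
  | insert i s hi ih =>
    rw [Finset.sum_insert hi]
    exact (hF i (Finset.mem_insert_self i s)).add
      (ih fun j hj => hF j (Finset.mem_insert_of_mem hj))

theorem coeff_mul_mul_pow (φ ψ : ℝ⟦X⟧) (h : ℝ) (n : ℕ) :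
    coeff n (φ * ψ) * h ^ n = ∑ kl ∈ Finset.HasAntidiagonal.antidiagonal n,
      (coeff kl.1 φ * h ^ kl.1) * (coeff kl.2 ψ * h ^ kl.2) := by
  rw [coeff_mul, Finset.sum_mul]
  refine Finset.sum_congr rfl fun kl hkl => ?_
  rw [← Finset.HasAntidiagonal.mem_antidiagonal.1 hkl, pow_add]
  ring

theorem mul (hφ : ConvergesOn ρ φ) (hψ : ConvergesOn ρ ψ) : ConvergesOn ρ (φ * ψ) := by
  intro h hh
  simp only [coeff_mul_mul_pow]
  exact summable_norm_sum_mul_antidiagonal_of_summable_norm (f := fun n => coeff n φ * h ^ n)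
    (g := fun n => coeff n ψ * h ^ n) (hφ h hh) (hψ h hh)

/-- Termwise differentiation does not shrink the interval of convergence. -/
theorem derivative (hφ : ConvergesOn ρ φ) : ConvergesOn ρ (d⁄dX ℝ φ) := by
  intro h hh
  obtain ⟨r, hr, hrρ⟩ := exists_between hh
  have hr0 : 0 < r := (abs_nonneg h).trans_lt hr
  have hq : ‖|h| / r‖ < 1 := by
    rw [Real.norm_eq_abs, abs_of_nonneg (by positivity), div_lt_one hr0]
    exact hr
  have hlim : Tendsto (fun n : ℕ => (n + 1 : ℝ) * (|h| / r) ^ n) atTop (𝓝 0) := by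
    have h1 := (summable_pow_mul_geometric_of_norm_lt_one 1 hq).tendsto_atTop_zero
    have h2 := (summable_pow_mul_geometric_of_norm_lt_one 0 hq).tendsto_atTop_zero
    simpa [add_mul] using h1.add h2
  obtain ⟨C, hC⟩ := hlim.bddAbove_range
  have hs : Summable fun n => ‖coeff (n + 1) φ * r ^ (n + 1)‖ :=
    (summable_nat_add_iff 1).2 (hφ r (by rwa [abs_of_pos hr0]))
  refine (hs.mul_left (C / r)).of_nonneg_of_le (fun n => norm_nonneg _) fun n => ?_
  have hCn : (n + 1 : ℝ) * (|h| / r) ^ n ≤ C := hC (mem_range_self n)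
  rw [coeff_derivative, norm_mul, norm_mul, norm_mul, norm_pow, norm_pow, Real.norm_of_nonneg
    hr0.le, Real.norm_of_nonneg (show (0 : ℝ) ≤ n + 1 by positivity), Real.norm_eq_abs h]
  have h3 : (n + 1 : ℝ) * |h| ^ n ≤ C * r ^ n := by
    rw [div_pow, mul_div_assoc', div_le_iff₀ (by positivity)] at hCn
    exact hCn
  calc ‖coeff (n + 1) φ‖ * (n + 1 : ℝ) * |h| ^ n
      = ‖coeff (n + 1) φ‖ * ((n + 1 : ℝ) * |h| ^ n) := by ring
    _ ≤ ‖coeff (n + 1) φ‖ * (C * r ^ n) := by gcongr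
    _ = C / r * (‖coeff (n + 1) φ‖ * r ^ (n + 1)) := by rw [pow_succ]; field_simp

end ConvergesOn

section evalAt

variable {ρ h : ℝ} {φ ψ : ℝ⟦X⟧}

theorem evalAt_add (hφ : ConvergesOn ρ φ) (hψ : ConvergesOn ρ ψ) (hh : |h| < ρ) :
    evalAt h (φ + ψ) = evalAt h φ + evalAt h ψ := by
  refine HasSum.unique ((hφ.add hψ).hasSum hh) ?_
  simpa [add_mul] using (hφ.hasSum hh).add (hψ.hasSum hh)

theorem evalAt_smul (c : ℝ) : evalAt h (c • φ) = c * evalAt h φ := by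
  rw [evalAt, evalAt, ← tsum_mul_left]
  simp [mul_assoc]

theorem evalAt_neg : evalAt h (-φ) = -evalAt h φ := by
  simpa using evalAt_smul (h := h) (φ := φ) (-1)

theorem evalAt_sub (hφ : ConvergesOn ρ φ) (hψ : ConvergesOn ρ ψ) (hh : |h| < ρ) :
    evalAt h (φ - ψ) = evalAt h φ - evalAt h ψ := by
  rw [sub_eq_add_neg, evalAt_add hφ hψ.neg hh, evalAt_neg, sub_eq_add_neg]

theorem evalAt_sum {ι : Type*} (s : Finset ι) {F : ι → ℝ⟦X⟧}
    (hF : ∀ i ∈ s, ConvergesOn ρ (F i)) (hh : |h| < ρ) :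
    evalAt h (∑ i ∈ s, F i) = ∑ i ∈ s, evalAt h (F i) := by
  refine HasSum.unique ((ConvergesOn.sum s hF).hasSum hh) ?_
  have := hasSum_sum (f := fun i n => coeff n (F i) * h ^ n) fun i hi => (hF i hi).hasSum hh
  simpa [Finset.sum_mul] using this

theorem evalAt_mul (hφ : ConvergesOn ρ φ) (hψ : ConvergesOn ρ ψ) (hh : |h| < ρ) :
    evalAt h (φ * ψ) = evalAt h φ * evalAt h ψ := by
  rw [evalAt, evalAt, evalAt, tsum_mul_tsum_eq_tsum_sum_antidiagonal_of_summable_norm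
    (hφ h hh) (hψ h hh)]
  simp only [ConvergesOn.coeff_mul_mul_pow]

theorem hasDerivAt_evalAt (hφ : ConvergesOn ρ φ) (hh : |h| < ρ) :
    HasDerivAt (fun s => evalAt s φ) (evalAt h (d⁄dX ℝ φ)) h := by
  obtain ⟨r, hr, hrρ⟩ := exists_between hh
  have hr0 : 0 < r := (abs_nonneg h).trans_lt hr
  have hsum := hφ.derivative r (by rwa [abs_of_pos hr0])
  have hmain : HasDerivAt (fun s => ∑' n, coeff (n + 1) φ * s ^ (n + 1))
      (∑' n, coeff n (d⁄dX ℝ φ) * h ^ n) h := by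
    refine hasDerivAt_tsum_of_isPreconnected (F := ℝ)
      (g := fun n s => coeff (n + 1) φ * s ^ (n + 1))
      (g' := fun n s => coeff n (d⁄dX ℝ φ) * s ^ n) (t := Ioo (-r) r) (y₀ := 0) hsum isOpen_Ioo
      isPreconnected_Ioo ?_ ?_ ⟨by linarith, hr0⟩ ?_ (abs_lt.1 hr)
    · intro n y _
      have := (hasDerivAt_pow (n + 1) y).const_mul (coeff (n + 1) φ)
      convert! this using 1
      rw [coeff_derivative]
      push_cast
      ring
    · intro n y hy
      rw [norm_mul, norm_mul, norm_pow, norm_pow]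
      have : ‖y‖ ≤ ‖r‖ := by
        rw [Real.norm_eq_abs, Real.norm_of_nonneg hr0.le]
        exact (abs_lt.2 hy).le
      gcongr
    · simp
  refine (hmain.const_add (coeff 0 φ)).congr_of_eventuallyEq ?_
  have hopen : IsOpen {s : ℝ | |s| < ρ} := isOpen_lt continuous_abs continuous_const
  filter_upwards [hopen.mem_nhds hh] with s hs
  rw [evalAt, (hφ.hasSum hs).summable.tsum_eq_zero_add]
  simp

end evalAt

/-- A real function analytic at `x₀` is the sum of a power series with geometrically bounded
coefficients. -/
theorem exists_powerSeries_of_analyticAt {g : ℝ → ℝ} {x₀ : ℝ} (hg : AnalyticAt ℝ g x₀) :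
    ∃ (φ : ℝ⟦X⟧) (C A : ℝ), 0 < C ∧ 0 < A ∧ (∀ n, |coeff n φ| ≤ C * A ^ n) ∧
      ∀ h, |h| < A⁻¹ → g (x₀ + h) = evalAt h φ := by
  obtain ⟨p, r, hp⟩ := hg
  obtain ⟨s, hs0, hsr⟩ := ENNReal.lt_iff_exists_nnreal_btwn.1 hp.r_pos
  have hs0' : 0 < s := by exact_mod_cast hs0
  obtain ⟨C, hC, hCb⟩ := p.norm_mul_pow_le_of_lt_radius (hsr.trans_le hp.r_le)
  refine ⟨PowerSeries.mk p.coeff, C, (s : ℝ)⁻¹, hC, by positivity, fun n => ?_, fun h hh => ?_⟩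
  · have := hCb n
    rw [coeff_mk, inv_pow, ← div_eq_mul_inv, le_div_iff₀ (by positivity), ← Real.norm_eq_abs,
      FormalMultilinearSeries.norm_apply_eq_norm_coef] at *
    exact this
  · rw [inv_inv] at hh
    have hmem : h ∈ Metric.eball (0 : ℝ) r := by
      rw [Metric.mem_eball, edist_zero_right]
      refine lt_trans ?_ hsr
      rw [enorm_eq_nnnorm, ENNReal.coe_lt_coe]
      exact_mod_cast hh
    have := (hp.hasSum hmem).tsum_eq
    rw [← this, evalAt]
    refine tsum_congr fun n => ?_
    rw [FormalMultilinearSeries.apply_eq_pow_smul_coeff, smul_eq_mul, mul_comm, coeff_mk]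

/-- A power series in one real variable with geometrically bounded coefficients in a Banach space
has an analytic sum. -/
theorem analyticAt_tsum_pow_smul {E : Type*} [NormedAddCommGroup E] [NormedSpace ℝ E]
    [CompleteSpace E] {c : ℕ → E} {C A : ℝ} (hA : 0 < A) (hc : ∀ n, ‖c n‖ ≤ C * A ^ n) :
    AnalyticAt ℝ (fun x : ℝ => ∑' n, x ^ n • c n) 0 := by
  let p : FormalMultilinearSeries ℝ ℝ E := fun n =>
    ContinuousMultilinearMap.mkPiRing ℝ (Fin n) (c n)
  obtain ⟨r, hrA⟩ : ∃ r : NNReal, (r : ℝ) = A⁻¹ := ⟨⟨A⁻¹, by positivity⟩, rfl⟩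
  have hr : (r : ENNReal) ≤ p.radius := by
    refine p.le_radius_of_bound C fun n => ?_
    rw [hrA]
    rw [ContinuousMultilinearMap.norm_mkPiRing]
    calc ‖c n‖ * A⁻¹ ^ n ≤ C * A ^ n * A⁻¹ ^ n := by gcongr; exact hc n
      _ = C := by rw [mul_assoc, ← mul_pow, mul_inv_cancel₀ hA.ne', one_pow, mul_one]
  have hpos : 0 < p.radius := lt_of_lt_of_le (by simpa [← NNReal.coe_pos, hrA] using hA) hr
  have := (p.hasFPowerSeriesOnBall hpos).analyticAt
  convert! this using 1
  ext x
  simp [FormalMultilinearSeries.sum, p]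

/-- A double power series with geometrically bounded coefficients has a jointly analytic sum. The
inner sums are the coordinates of an analytic curve `x ↦ W x` of bounded sequences, and the outer
sum is the value at `W x` of a functional that depends analytically on `t`. -/
theorem analyticAt_tsum_evalAt {c : ℕ → ℝ⟦X⟧} {C A B : ℝ} (hA : 0 < A) (hB : 0 < B)
    (hc : ∀ n m, |coeff m (c n)| ≤ C * B ^ n * A ^ m) :
    AnalyticAt ℝ (fun p : ℝ × ℝ => ∑' n, evalAt p.1 (c n) * p.2 ^ n) (0, 0) := by
  -- Dividing by `B ^ n` makes the `m`-th coefficients a bounded sequence in `n`; the factor `B ^ n`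
  -- is returned to the functionals `e n` below.
  have hbd : ∀ m n, ‖coeff m (c n) / B ^ n‖ ≤ C * A ^ m := fun m n => by
    rw [norm_div, norm_pow, Real.norm_of_nonneg hB.le, div_le_iff₀ (by positivity)]
    refine (hc n m).trans_eq (by ring)
  let w : ℕ → BoundedContinuousFunction ℕ ℝ := fun m =>
    BoundedContinuousFunction.ofNormedAddCommGroup (fun n => coeff m (c n) / B ^ n)
      continuous_of_discreteTopology (C * A ^ m) (hbd m)
  have hC : 0 ≤ C := by
    have := (abs_nonneg _).trans (hc 0 0)
    simpa using this
  have hw : ∀ m, ‖w m‖ ≤ C * A ^ m := fun m =>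
    BoundedContinuousFunction.norm_ofNormedAddCommGroup_le _
      (show 0 ≤ C * A ^ m by positivity) (hbd m)
  let e : ℕ → BoundedContinuousFunction ℕ ℝ →L[ℝ] ℝ := fun n =>
    B ^ n • BoundedContinuousFunction.evalCLM ℝ n
  have he : ∀ n, ‖e n‖ ≤ 1 * B ^ n := fun n => by
    refine ContinuousLinearMap.opNorm_le_bound _ (by positivity) fun g => ?_
    rw [one_mul, smul_apply, norm_smul, norm_pow, Real.norm_of_nonneg hB.le]
    gcongr
    exact g.norm_coe_le_norm n
  have h1 : AnalyticAt ℝ (fun p : ℝ × ℝ => ∑' m, p.1 ^ m • w m) (0, 0) :=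
    AnalyticAt.fun_comp (f := Prod.fst) (x := ((0 : ℝ), (0 : ℝ)))
      (analyticAt_tsum_pow_smul hA hw) analyticAt_fst
  have h2 : AnalyticAt ℝ (fun p : ℝ × ℝ => ∑' n, p.2 ^ n • e n) (0, 0) :=
    AnalyticAt.fun_comp (f := Prod.snd) (x := ((0 : ℝ), (0 : ℝ)))
      (analyticAt_tsum_pow_smul hB he) analyticAt_snd
  have h3 := (h2.contDiffAt (n := ω)).clm_apply h1.contDiffAt
  refine (h3.analyticAt).congr ?_
  have ho : IsOpen {p : ℝ × ℝ | |p.1| * A < 1 ∧ |p.2| * B < 1} :=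
    (isOpen_lt (f := fun p : ℝ × ℝ => |p.1| * A) (by fun_prop) continuous_const).inter
      (isOpen_lt (f := fun p : ℝ × ℝ => |p.2| * B) (by fun_prop) continuous_const)
  filter_upwards [ho.mem_nhds (by simp)] with p hp
  have key : ∀ {E : Type} [NormedAddCommGroup E] [NormedSpace ℝ E] [CompleteSpace E] {d : ℕ → E}
      {C' D s : ℝ}, 0 < D → (∀ n, ‖d n‖ ≤ C' * D ^ n) → |s| * D < 1 →
      Summable fun n => s ^ n • d n := by
    intro E _ _ _ d C' D s hD hd hs
    refine Summable.of_norm_bounded ((summable_geometric_of_lt_one (by positivity) hs).mul_left C')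
      fun n => ?_
    rw [norm_smul, norm_pow, Real.norm_eq_abs, mul_pow]
    calc |s| ^ n * ‖d n‖ ≤ |s| ^ n * (C' * D ^ n) := by gcongr; exact hd n
      _ = _ := by ring
  have s1 := key hA hw hp.1
  have s2 := key (E := BoundedContinuousFunction ℕ ℝ →L[ℝ] ℝ) hB he hp.2
  have hap := (ContinuousLinearMap.apply ℝ ℝ (∑' m, p.1 ^ m • w m)).map_tsum s2
  simp only [ContinuousLinearMap.apply_apply] at hap
  rw [hap]
  refine tsum_congr fun n => ?_
  have hev := (BoundedContinuousFunction.evalCLM (β := ℝ) ℝ n).map_tsum s1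
  simp only [smul_apply, e]
  rw [hev, evalAt, ← tsum_mul_right, smul_eq_mul, smul_eq_mul, ← tsum_mul_left, ← tsum_mul_left]
  refine tsum_congr fun m => ?_
  simp only [map_smul, smul_eq_mul, BoundedContinuousFunction.evalCLM_apply, w,
    BoundedContinuousFunction.coe_ofNormedAddCommGroup]
  field_simp

/-! ### Majorants -/

/-- `φ` is majorized by `ψ`: every coefficient of `φ` is bounded in absolute value by the
corresponding coefficient of `ψ`. -/
def IsMajorizedBy (φ ψ : ℝ⟦X⟧) : Prop := ∀ n, |coeff n φ| ≤ coeff n ψ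

namespace IsMajorizedBy

variable {φ φ' ψ ψ' : ℝ⟦X⟧}

theorem coeff_nonneg (h : IsMajorizedBy φ ψ) (n : ℕ) : 0 ≤ coeff n ψ :=
  (abs_nonneg _).trans (h n)

theorem add (h : IsMajorizedBy φ ψ) (h' : IsMajorizedBy φ' ψ') :
    IsMajorizedBy (φ + φ') (ψ + ψ') := fun n => by
  rw [map_add, map_add]
  exact (abs_add_le _ _).trans (add_le_add (h n) (h' n))

theorem neg (h : IsMajorizedBy φ ψ) : IsMajorizedBy (-φ) ψ := fun n => by
  rw [map_neg, abs_neg]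
  exact h n

theorem sub (h : IsMajorizedBy φ ψ) (h' : IsMajorizedBy φ' ψ') :
    IsMajorizedBy (φ - φ') (ψ + ψ') := by
  rw [sub_eq_add_neg]
  exact h.add h'.neg

theorem smul (h : IsMajorizedBy φ ψ) {c : ℝ} (hc : 0 ≤ c) :
    IsMajorizedBy (c • φ) (c • ψ) := fun n => by
  rw [PowerSeries.coeff_smul, PowerSeries.coeff_smul, smul_eq_mul, smul_eq_mul, abs_mul,
    abs_of_nonneg hc]
  exact mul_le_mul_of_nonneg_left (h n) hc

theorem mul (h : IsMajorizedBy φ ψ) (h' : IsMajorizedBy φ' ψ') :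
    IsMajorizedBy (φ * φ') (ψ * ψ') := fun n => by
  rw [coeff_mul, coeff_mul]
  refine (Finset.abs_sum_le_sum_abs _ _).trans (Finset.sum_le_sum fun kl _ => ?_)
  rw [abs_mul]
  exact mul_le_mul (h _) (h' _) (abs_nonneg _) (h.coeff_nonneg _)

theorem derivative (h : IsMajorizedBy φ ψ) : IsMajorizedBy (d⁄dX ℝ φ) (d⁄dX ℝ ψ) := fun n => by
  rw [coeff_derivative, coeff_derivative, abs_mul,
    abs_of_nonneg (show (0 : ℝ) ≤ n + 1 by positivity)]
  exact mul_le_mul_of_nonneg_right (h _) (by positivity)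

theorem sum {ι : Type*} (s : Finset ι) {F G : ι → ℝ⟦X⟧}
    (h : ∀ i ∈ s, IsMajorizedBy (F i) (G i)) : IsMajorizedBy (∑ i ∈ s, F i) (∑ i ∈ s, G i) :=
  fun n => by
    rw [map_sum, map_sum]
    exact (Finset.abs_sum_le_sum_abs _ _).trans (Finset.sum_le_sum fun i hi => h i hi n)

end IsMajorizedBy

/-- The geometric series `1 / (1 - A X)`. -/
noncomputable def geom (A : ℝ) : ℝ⟦X⟧ := rescale A (PowerSeries.mk 1)

theorem coeff_geom (A : ℝ) (n : ℕ) : coeff n (geom A) = A ^ n := by simp [geom, coeff_rescale]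

theorem coeff_geom_pow_succ (A : ℝ) (d n : ℕ) :
    coeff n (geom A ^ (d + 1)) = A ^ n * ((d + n).choose d : ℕ) := by
  rw [geom, ← map_pow, mk_one_pow_eq_mk_choose_add, coeff_rescale, coeff_mk]

theorem derivative_geom (A : ℝ) : d⁄dX ℝ (geom A) = A • geom A ^ 2 := by
  ext n
  rw [coeff_derivative, coeff_geom, PowerSeries.coeff_smul, coeff_geom_pow_succ, smul_eq_mul,
    Nat.choose_one_right]
  push_cast
  ring

theorem derivative_geom_pow (A : ℝ) (d : ℕ) :
    d⁄dX ℝ (geom A ^ (d + 1)) = ((d + 1 : ℝ) * A) • geom A ^ (d + 2) := by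
  rw [Derivation.leibniz_pow, derivative_geom, Nat.add_sub_cancel, smul_eq_mul, mul_smul_comm,
    ← pow_add, mul_smul, ← Nat.cast_smul_eq_nsmul ℝ]
  push_cast
  rfl

/-! ### The coefficients of the solution in powers of `t` -/

/-- The coefficients `(uₙ, vₙ)` of the formal solution `u = ∑ uₙ tⁿ`, `v = ∑ vₙ tⁿ` of the
dispersionless focusing NLS system with value `w₀` at `t = 0`, in any real algebra with a map `D`
that plays the role of `∂/∂x`. It is used both for real functions (with `D = deriv`) and for formal
power series in `x`. -/
noncomputable def timeCoeff {R : Type*} [CommRing R] [Algebra ℝ R] (D : R → R) (w₀ : R × R) :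
    ℕ → R × R
  | 0 => w₀
  | n + 1 =>
    ((n + 1 : ℝ)⁻¹ • -∑ k : Fin (n + 1), ((timeCoeff D w₀ k).2 * D (timeCoeff D w₀ (n - k)).1 +
        (timeCoeff D w₀ k).1 * D (timeCoeff D w₀ (n - k)).2),
      (n + 1 : ℝ)⁻¹ • (D (timeCoeff D w₀ n).1 -
        ∑ k : Fin (n + 1), (timeCoeff D w₀ k).2 * D (timeCoeff D w₀ (n - k)).2))

section timeCoeff

variable {R : Type*} [CommRing R] [Algebra ℝ R] (D : R → R) (w₀ : R × R)

theorem timeCoeff_zero : timeCoeff D w₀ 0 = w₀ := by rw [timeCoeff]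

theorem timeCoeff_succ_fst (n : ℕ) :
    (timeCoeff D w₀ (n + 1)).1 = (n + 1 : ℝ)⁻¹ • -∑ kl ∈ Finset.HasAntidiagonal.antidiagonal n,
      ((timeCoeff D w₀ kl.1).2 * D (timeCoeff D w₀ kl.2).1 +
        (timeCoeff D w₀ kl.1).1 * D (timeCoeff D w₀ kl.2).2) := by
  rw [timeCoeff, Finset.Nat.sum_antidiagonal_eq_sum_range_succ_mk, Finset.sum_range]

theorem timeCoeff_succ_snd (n : ℕ) :
    (timeCoeff D w₀ (n + 1)).2 = (n + 1 : ℝ)⁻¹ • (D (timeCoeff D w₀ n).1 -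
      ∑ kl ∈ Finset.HasAntidiagonal.antidiagonal n,
        (timeCoeff D w₀ kl.1).2 * D (timeCoeff D w₀ kl.2).2) := by
  rw [timeCoeff, Finset.Nat.sum_antidiagonal_eq_sum_range_succ_mk, Finset.sum_range]

end timeCoeff

theorem catalan_le_catalan_succ (n : ℕ) : catalan n ≤ catalan (n + 1) := by
  rw [catalan_succ']
  refine le_trans ?_ (Finset.single_le_sum (f := fun ij : ℕ × ℕ => catalan ij.1 * catalan ij.2)
    (fun _ _ => Nat.zero_le _)
    (Finset.HasAntidiagonal.mem_antidiagonal.2 (show (0, n).1 + (0, n).2 = n from zero_add n)))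
  simp

theorem catalan_le_four_pow (n : ℕ) : catalan n ≤ 4 ^ n := by
  rw [catalan_eq_centralBinom_div]
  refine (Nat.div_le_self _ _).trans ?_
  rw [Nat.centralBinom, show 4 ^ n = 2 ^ (2 * n) by rw [pow_mul]; norm_num]
  exact Nat.choose_le_two_pow _ _

theorem IsMajorizedBy.mul_derivative_geom {φ ψ : ℝ⟦X⟧} {a b A : ℝ} {i j : ℕ}
    (hφ : IsMajorizedBy φ (a • geom A ^ (2 * i + 1)))
    (hψ : IsMajorizedBy ψ (b • geom A ^ (2 * j + 1))) :
    IsMajorizedBy (φ * d⁄dX ℝ ψ) ((a * b * ((2 * j + 1) * A)) • geom A ^ (2 * (i + j + 1) + 1)) := by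
  have := hφ.mul hψ.derivative
  convert! this using 1
  rw [Derivation.map_smul, derivative_geom_pow, smul_mul_smul_comm, mul_smul_comm, ← pow_add,
    smul_smul]
  push_cast
  ring_nf

theorem IsMajorizedBy.smul_geom_mono {φ : ℝ⟦X⟧} {c c' A : ℝ} {d d' : ℕ} (hA : 0 ≤ A)
    (hc : 0 ≤ c) (hcc : c ≤ c') (hd : d ≤ d')
    (hφ : IsMajorizedBy φ (c • geom A ^ (d + 1))) :
    IsMajorizedBy φ (c' • geom A ^ (d' + 1)) := fun n => by
  refine (hφ n).trans ?_
  rw [PowerSeries.coeff_smul, PowerSeries.coeff_smul, smul_eq_mul, smul_eq_mul,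
    coeff_geom_pow_succ, coeff_geom_pow_succ]
  have : (d + n).choose d ≤ (d' + n).choose d' := by
    rw [Nat.choose_symm_add, Nat.choose_symm_add]
    exact Nat.choose_le_choose _ (by omega)
  have : (((d + n).choose d : ℕ) : ℝ) ≤ ((d' + n).choose d' : ℕ) := by exact_mod_cast this
  gcongr
  exact hc.trans hcc

/-- The majorant of the formal solution. Multiplying two coefficients and differentiating one of
them raises the total power of `1 / (1 - A X)` by one, which the exponents `2 n + 1` absorb, while
the quadratic recursion for the constants is that of the Catalan numbers. -/
theorem isMajorizedBy_timeCoeff {w₀ : ℝ⟦X⟧ × ℝ⟦X⟧} {C A : ℝ} (hC : 0 < C) (hA : 0 < A)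
    (h₁ : ∀ n, |coeff n w₀.1| ≤ C * A ^ n) (h₂ : ∀ n, |coeff n w₀.2| ≤ C * A ^ n) (n : ℕ) :
    IsMajorizedBy (timeCoeff (d⁄dX ℝ) w₀ n).1
        ((C * (4 * A * (C + 1)) ^ n * catalan n) • geom A ^ (2 * n + 1)) ∧
      IsMajorizedBy (timeCoeff (d⁄dX ℝ) w₀ n).2
        ((C * (4 * A * (C + 1)) ^ n * catalan n) • geom A ^ (2 * n + 1)) := by
  set L := 4 * A * (C + 1) with hL
  have hL0 : 0 < L := by positivity
  induction n using Nat.strong_induction_on with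
  | _ n ih =>
  rcases n with _ | n
  · rw [timeCoeff_zero]
    constructor <;> intro n <;> simp [coeff_geom, h₁, h₂]
  -- Each sum in the recursion has terms with constants `∼ cₖ cₗ`, `k + l = n`, whose sum is `cₙ₊₁`;
  -- the factor `2 (n + 1)` from the derivative is absorbed by the `1 / (n + 1)` of the recursion.
  have hS : ∀ F : ℕ × ℕ → ℝ⟦X⟧, (∀ kl ∈ Finset.HasAntidiagonal.antidiagonal n, IsMajorizedBy (F kl)
      (((C * L ^ kl.1 * catalan kl.1) * (C * L ^ kl.2 * catalan kl.2) * ((2 * kl.2 + 1) * A)) •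
        geom A ^ (2 * (kl.1 + kl.2 + 1) + 1))) →
      IsMajorizedBy (∑ kl ∈ Finset.HasAntidiagonal.antidiagonal n, F kl)
        ((2 * (n + 1) * A * C ^ 2 * L ^ n * catalan (n + 1)) • geom A ^ (2 * (n + 1) + 1)) := by
    intro F hF
    have h1 : ∀ kl ∈ Finset.HasAntidiagonal.antidiagonal n, IsMajorizedBy (F kl)
        ((2 * (n + 1) * A * C ^ 2 * L ^ n * (catalan kl.1 * catalan kl.2 : ℕ)) •
          geom A ^ (2 * (n + 1) + 1)) := by
      intro kl hkl
      have hkln := Finset.HasAntidiagonal.mem_antidiagonal.1 hkl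
      refine (hF kl hkl).smul_geom_mono hA.le (by positivity) ?_ (by omega)
      have h2 : (2 * (kl.2 : ℝ) + 1) ≤ 2 * (n + 1) := by
        have : (kl.2 : ℝ) ≤ n := by exact_mod_cast (by omega : kl.2 ≤ n)
        linarith
      calc (C * L ^ kl.1 * catalan kl.1) * (C * L ^ kl.2 * catalan kl.2) * ((2 * kl.2 + 1) * A)
          = C ^ 2 * L ^ (kl.1 + kl.2) * (catalan kl.1 * catalan kl.2) * A * (2 * kl.2 + 1) := by ring
        _ ≤ C ^ 2 * L ^ (kl.1 + kl.2) * (catalan kl.1 * catalan kl.2) * A * (2 * (n + 1)) := by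
          gcongr
        _ = _ := by rw [hkln]; push_cast; ring
    have h3 := IsMajorizedBy.sum _ h1
    rwa [← Finset.sum_smul, ← Finset.mul_sum, ← Nat.cast_sum, ← catalan_succ'] at h3
  have ihk : ∀ k, k ≤ n → _ := fun k hk => ih k (Nat.lt_succ_of_le hk)
  have hn0 : (0 : ℝ) < n + 1 := by positivity
  have hlt : ∀ kl ∈ Finset.HasAntidiagonal.antidiagonal n, kl.1 ≤ n ∧ kl.2 ≤ n := fun kl hkl => by
    have := Finset.HasAntidiagonal.mem_antidiagonal.1 hkl
    omega
  have hcat : (0 : ℝ) ≤ catalan (n + 1) := Nat.cast_nonneg _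
  constructor
  · rw [timeCoeff_succ_fst, Finset.sum_add_distrib]
    have h4 := ((hS _ fun kl hkl => (ihk kl.1 (hlt kl hkl).1).2.mul_derivative_geom
      (ihk kl.2 (hlt kl hkl).2).1).add (hS _ fun kl hkl =>
        (ihk kl.1 (hlt kl hkl).1).1.mul_derivative_geom (ihk kl.2 (hlt kl hkl).2).2)).neg.smul
      (inv_nonneg.2 hn0.le)
    rw [← add_smul, smul_smul] at h4
    refine h4.smul_geom_mono hA.le (by positivity) ?_ le_rfl
    have : (n + 1 : ℝ)⁻¹ * (2 * (n + 1) * A * C ^ 2 * L ^ n * catalan (n + 1) +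
        2 * (n + 1) * A * C ^ 2 * L ^ n * catalan (n + 1)) =
        C * L ^ n * catalan (n + 1) * (4 * A * C) := by field_simp; ring
    rw [this, pow_succ]
    calc C * L ^ n * catalan (n + 1) * (4 * A * C) ≤ C * L ^ n * catalan (n + 1) * L := by
          gcongr
          rw [hL]
          gcongr
          linarith
      _ = _ := by ring
  · rw [timeCoeff_succ_snd]
    have h5 : IsMajorizedBy (d⁄dX ℝ (timeCoeff (d⁄dX ℝ) w₀ n).1)
        ((2 * (n + 1) * A * C * L ^ n * catalan (n + 1)) • geom A ^ (2 * (n + 1) + 1)) := by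
      have := (ihk n le_rfl).1.derivative
      rw [Derivation.map_smul, derivative_geom_pow, smul_smul] at this
      refine this.smul_geom_mono (d := 2 * n + 1) hA.le (by positivity) ?_ (by omega)
      have hc1 : (catalan n : ℝ) ≤ catalan (n + 1) := by exact_mod_cast catalan_le_catalan_succ n
      push_cast
      calc C * L ^ n * catalan n * ((2 * n + 1) * A)
          ≤ C * L ^ n * catalan (n + 1) * ((2 * (n + 1)) * A) := by
            gcongr
            linarith
        _ = _ := by ring
    have h4 := (h5.sub (hS _ fun kl hkl => (ihk kl.1 (hlt kl hkl).1).2.mul_derivative_geom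
      (ihk kl.2 (hlt kl hkl).2).2)).smul (inv_nonneg.2 hn0.le)
    rw [← add_smul, smul_smul] at h4
    refine h4.smul_geom_mono hA.le (by positivity) ?_ le_rfl
    have : (n + 1 : ℝ)⁻¹ * (2 * (n + 1) * A * C * L ^ n * catalan (n + 1) +
        2 * (n + 1) * A * C ^ 2 * L ^ n * catalan (n + 1)) =
        C * L ^ n * catalan (n + 1) * (2 * A * (C + 1)) := by field_simp; ring
    rw [this, pow_succ]
    calc C * L ^ n * catalan (n + 1) * (2 * A * (C + 1)) ≤ C * L ^ n * catalan (n + 1) * L := by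
          gcongr
          rw [hL]
          gcongr
          norm_num
      _ = _ := by ring

/-- The coefficients of the formal solution in powers of `x` and `t` are geometrically bounded. -/
theorem abs_coeff_timeCoeff_le {w₀ : ℝ⟦X⟧ × ℝ⟦X⟧} {C A : ℝ} (hC : 0 < C) (hA : 0 < A)
    (h₁ : ∀ n, |coeff n w₀.1| ≤ C * A ^ n) (h₂ : ∀ n, |coeff n w₀.2| ≤ C * A ^ n) (n m : ℕ) :
    |coeff m (timeCoeff (d⁄dX ℝ) w₀ n).1| ≤ C * (64 * A * (C + 1)) ^ n * (2 * A) ^ m ∧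
      |coeff m (timeCoeff (d⁄dX ℝ) w₀ n).2| ≤ C * (64 * A * (C + 1)) ^ n * (2 * A) ^ m := by
  have h := isMajorizedBy_timeCoeff hC hA h₁ h₂ n
  have key : coeff m ((C * (4 * A * (C + 1)) ^ n * catalan n) • geom A ^ (2 * n + 1)) ≤
      C * (64 * A * (C + 1)) ^ n * (2 * A) ^ m := by
    rw [PowerSeries.coeff_smul, smul_eq_mul, coeff_geom_pow_succ]
    have h1 : (((2 * n + m).choose (2 * n) : ℕ) : ℝ) ≤ 2 ^ (2 * n + m) := by
      exact_mod_cast Nat.choose_le_two_pow _ _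
    have h2 : (catalan n : ℝ) ≤ 4 ^ n := by exact_mod_cast catalan_le_four_pow n
    calc C * (4 * A * (C + 1)) ^ n * catalan n * (A ^ m * ((2 * n + m).choose (2 * n) : ℕ))
        ≤ C * (4 * A * (C + 1)) ^ n * 4 ^ n * (A ^ m * 2 ^ (2 * n + m)) := by gcongr
      _ = _ := by
        rw [show 64 * A * (C + 1) = 4 * A * (C + 1) * 4 * 2 ^ 2 by ring, mul_pow _ (2 ^ 2 : ℝ),
          mul_pow _ (4 : ℝ), mul_pow 2 A, pow_add, pow_mul]
        ring
  exact ⟨(h.1 m).trans key, (h.2 m).trans key⟩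

/-! ### Local solution of the Cauchy problem -/

theorem abs_evalAt_le {φ : ℝ⟦X⟧} {K A h : ℝ} (hA : 0 < A) (hφ : ∀ m, |coeff m φ| ≤ K * A ^ m)
    (hh : |h| ≤ (2 * A)⁻¹) : |evalAt h φ| ≤ 2 * K := by
  have hs : HasSum (fun m : ℕ => K * (1 / 2 : ℝ) ^ m) (2 * K) := by
    rw [mul_comm 2 K]
    exact hasSum_geometric_two.mul_left K
  refine tsum_of_norm_bounded (f := fun m => coeff m φ * h ^ m) hs fun m => ?_
  rw [norm_mul, norm_pow, Real.norm_eq_abs, Real.norm_eq_abs]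
  have hK : 0 ≤ K := by simpa using (abs_nonneg _).trans (hφ 0)
  calc |coeff m φ| * |h| ^ m ≤ K * A ^ m * (2 * A)⁻¹ ^ m := by gcongr; exact hφ m
    _ = K * (1 / 2) ^ m := by
      rw [mul_assoc, ← mul_pow]
      congr 2
      field_simp

theorem abs_coeff_derivative_le {φ : ℝ⟦X⟧} {K A : ℝ} (hA : 0 < A)
    (hφ : ∀ m, |coeff m φ| ≤ K * A ^ m) (m : ℕ) :
    |coeff m (d⁄dX ℝ φ)| ≤ K * A * (2 * A) ^ m := by
  have hK : 0 ≤ K := by simpa using (abs_nonneg _).trans (hφ 0)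
  have h2 : (m + 1 : ℝ) ≤ 2 ^ m := by exact_mod_cast Nat.lt_two_pow_self (n := m)
  rw [coeff_derivative, abs_mul, abs_of_nonneg (show (0 : ℝ) ≤ m + 1 by positivity)]
  calc |coeff (m + 1) φ| * (m + 1 : ℝ) ≤ K * A ^ (m + 1) * 2 ^ m := by gcongr; exact hφ _
    _ = K * A * (2 * A) ^ m := by rw [mul_pow]; ring

theorem hasDerivAt_of_eq_evalAt {g : ℝ → ℝ} {x₀ ρ : ℝ} {φ : ℝ⟦X⟧} (hφ : ConvergesOn ρ φ)
    (hg : ∀ h, |h| < ρ → g (x₀ + h) = evalAt h φ) {h : ℝ} (hh : |h| < ρ) :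
    HasDerivAt g (evalAt h (d⁄dX ℝ φ)) (x₀ + h) := by
  have h1 : HasDerivAt (fun s => evalAt (s - x₀) φ) (evalAt h (d⁄dX ℝ φ)) (x₀ + h) := by
    refine HasDerivAt.comp_sub_const (f := fun s => evalAt s φ) (x₀ + h) x₀ ?_
    rw [add_sub_cancel_left]
    exact hasDerivAt_evalAt hφ hh
  refine h1.congr_of_eventuallyEq ?_
  have ho : IsOpen {s : ℝ | |s - x₀| < ρ} := isOpen_lt (by fun_prop) continuous_const
  filter_upwards [ho.mem_nhds (by simpa using hh)] with s hs
  rw [← hg _ hs, add_sub_cancel]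

/-- The coefficients of the formal solution in powers of `t`, as functions of `x`, are the sums
near a point of power series in `x` that converge uniformly well. -/
theorem exists_expansion_timeCoeff {uI vI : ℝ → ℝ} {x₀ : ℝ} (hu : AnalyticAt ℝ uI x₀)
    (hv : AnalyticAt ℝ vI x₀) :
    ∃ (C A B : ℝ) (c d : ℕ → ℝ⟦X⟧), 0 < A ∧ 0 < B ∧
      (∀ n m, |coeff m (c n)| ≤ C * B ^ n * A ^ m) ∧
      (∀ n m, |coeff m (d n)| ≤ C * B ^ n * A ^ m) ∧
      ∀ n h, |h| < A⁻¹ → (timeCoeff deriv (uI, vI) n).1 (x₀ + h) = evalAt h (c n) ∧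
        (timeCoeff deriv (uI, vI) n).2 (x₀ + h) = evalAt h (d n) := by
  obtain ⟨φ, C₁, A₁, hC₁, hA₁, hφ, hφe⟩ := exists_powerSeries_of_analyticAt hu
  obtain ⟨ψ, C₂, A₂, hC₂, hA₂, hψ, hψe⟩ := exists_powerSeries_of_analyticAt hv
  set C := max C₁ C₂
  set A := max A₁ A₂
  have hC : 0 < C := lt_max_of_lt_left hC₁
  have hA : 0 < A := lt_max_of_lt_left hA₁
  have hφ' : ∀ n, |coeff n φ| ≤ C * A ^ n := fun n => (hφ n).trans <| by
    gcongr <;> exact le_max_left _ _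
  have hψ' : ∀ n, |coeff n ψ| ≤ C * A ^ n := fun n => (hψ n).trans <| by
    gcongr <;> exact le_max_right _ _
  have hb := abs_coeff_timeCoeff_le (w₀ := (φ, ψ)) hC hA hφ' hψ'
  have hA2 : 0 < 2 * A := by positivity
  have hcu : ∀ n, ConvergesOn (2 * A)⁻¹ (timeCoeff (d⁄dX ℝ) (φ, ψ) n).1 := fun n =>
    .of_bound hA2 fun m => (hb n m).1
  have hcv : ∀ n, ConvergesOn (2 * A)⁻¹ (timeCoeff (d⁄dX ℝ) (φ, ψ) n).2 := fun n =>
    .of_bound hA2 fun m => (hb n m).2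
  refine ⟨C, 2 * A, 64 * A * (C + 1), fun n => (timeCoeff (d⁄dX ℝ) (φ, ψ) n).1,
    fun n => (timeCoeff (d⁄dX ℝ) (φ, ψ) n).2, hA2, by positivity,
    fun n m => (hb n m).1, fun n m => (hb n m).2, fun n => ?_⟩
  induction n using Nat.strong_induction_on with
  | _ n ih =>
  intro h hh
  rcases n with _ | n
  · simp only [timeCoeff_zero]
    have h1 : |h| < A₁⁻¹ := hh.trans_le <| by
      gcongr
      linarith [le_max_left A₁ A₂]
    have h2 : |h| < A₂⁻¹ := hh.trans_le <| by
      gcongr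
      linarith [le_max_right A₁ A₂]
    exact ⟨hφe h h1, hψe h h2⟩
  have hlt : ∀ kl ∈ Finset.HasAntidiagonal.antidiagonal n, kl.1 < n + 1 ∧ kl.2 < n + 1 :=
    fun kl hkl => by
      have := Finset.HasAntidiagonal.mem_antidiagonal.1 hkl
      omega
  have hdu : ∀ k < n + 1, deriv (timeCoeff deriv (uI, vI) k).1 (x₀ + h) =
      evalAt h (d⁄dX ℝ (timeCoeff (d⁄dX ℝ) (φ, ψ) k).1) := fun k hk =>
    (hasDerivAt_of_eq_evalAt (hcu k) (fun h hh => (ih k hk h hh).1) hh).deriv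
  have hdv : ∀ k < n + 1, deriv (timeCoeff deriv (uI, vI) k).2 (x₀ + h) =
      evalAt h (d⁄dX ℝ (timeCoeff (d⁄dX ℝ) (φ, ψ) k).2) := fun k hk =>
    (hasDerivAt_of_eq_evalAt (hcv k) (fun h hh => (ih k hk h hh).2) hh).deriv
  have hm1 : ∀ k l, ConvergesOn (2 * A)⁻¹
      ((timeCoeff (d⁄dX ℝ) (φ, ψ) k).2 * d⁄dX ℝ (timeCoeff (d⁄dX ℝ) (φ, ψ) l).1 +
        (timeCoeff (d⁄dX ℝ) (φ, ψ) k).1 * d⁄dX ℝ (timeCoeff (d⁄dX ℝ) (φ, ψ) l).2) :=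
    fun k l => ((hcv k).mul (hcu l).derivative).add ((hcu k).mul (hcv l).derivative)
  have hm2 : ∀ k l, ConvergesOn (2 * A)⁻¹
      ((timeCoeff (d⁄dX ℝ) (φ, ψ) k).2 * d⁄dX ℝ (timeCoeff (d⁄dX ℝ) (φ, ψ) l).2) :=
    fun k l => (hcv k).mul (hcv l).derivative
  have hs1 := evalAt_sum (h := h) (Finset.HasAntidiagonal.antidiagonal n)
    (fun kl _ => hm1 kl.1 kl.2) hh
  have hs2 := evalAt_sum (h := h) (Finset.HasAntidiagonal.antidiagonal n)
    (fun kl _ => hm2 kl.1 kl.2) hh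
  have hcs := ConvergesOn.sum (Finset.HasAntidiagonal.antidiagonal n)
    (fun kl _ => hm2 kl.1 kl.2)
  dsimp only
  constructor
  · rw [timeCoeff_succ_fst, timeCoeff_succ_fst, evalAt_smul, evalAt_neg, hs1]
    simp only [Pi.smul_apply, Pi.neg_apply, Finset.sum_apply, Pi.add_apply, Pi.mul_apply,
      smul_eq_mul]
    refine congrArg (fun z => ((n : ℝ) + 1)⁻¹ * -z) (Finset.sum_congr rfl fun kl hkl => ?_)
    obtain ⟨hk, hl⟩ := hlt kl hkl
    rw [evalAt_add ((hcv _).mul (hcu _).derivative) ((hcu _).mul (hcv _).derivative) hh,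
      evalAt_mul (hcv _) (hcu _).derivative hh, evalAt_mul (hcu _) (hcv _).derivative hh,
      hdu _ hl, hdv _ hl, (ih _ hk h hh).1, (ih _ hk h hh).2]
  · rw [timeCoeff_succ_snd, timeCoeff_succ_snd, evalAt_smul,
      evalAt_sub (hcu n).derivative hcs hh, hs2]
    simp only [Pi.smul_apply, Pi.sub_apply, Finset.sum_apply, Pi.mul_apply, smul_eq_mul]
    rw [hdu n n.lt_succ_self]
    refine congrArg (fun z => ((n : ℝ) + 1)⁻¹ * (_ - z)) (Finset.sum_congr rfl fun kl hkl => ?_)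
    obtain ⟨hk, hl⟩ := hlt kl hkl
    rw [evalAt_mul (hcv _) (hcv _).derivative hh, hdv _ hl, (ih _ hk h hh).2]

/-- The first component `∑ uₙ(x) tⁿ` of the solution of the Cauchy problem. -/
noncomputable def cauchyU (uI vI : ℝ → ℝ) (p : ℝ × ℝ) : ℝ :=
  ∑' n, (timeCoeff deriv (uI, vI) n).1 p.1 * p.2 ^ n

/-- The second component `∑ vₙ(x) tⁿ` of the solution of the Cauchy problem. -/
noncomputable def cauchyV (uI vI : ℝ → ℝ) (p : ℝ × ℝ) : ℝ :=
  ∑' n, (timeCoeff deriv (uI, vI) n).2 p.1 * p.2 ^ n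

theorem cauchyU_zero (uI vI : ℝ → ℝ) (x : ℝ) : cauchyU uI vI (x, 0) = uI x := by
  rw [cauchyU, tsum_eq_single 0 fun n hn => by simp [hn]]
  simp [timeCoeff_zero]

theorem cauchyV_zero (uI vI : ℝ → ℝ) (x : ℝ) : cauchyV uI vI (x, 0) = vI x := by
  rw [cauchyV, tsum_eq_single 0 fun n hn => by simp [hn]]
  simp [timeCoeff_zero]

theorem analyticAt_tsum_of_expansion {g : ℕ → ℝ → ℝ} {x₀ C A B : ℝ} {c : ℕ → ℝ⟦X⟧} (hA : 0 < A)
    (hB : 0 < B) (hc : ∀ n m, |coeff m (c n)| ≤ C * B ^ n * A ^ m)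
    (hg : ∀ n h, |h| < A⁻¹ → g n (x₀ + h) = evalAt h (c n)) :
    AnalyticAt ℝ (fun p : ℝ × ℝ => ∑' n, g n p.1 * p.2 ^ n) (x₀, 0) := by
  have h1 : AnalyticAt ℝ (fun p : ℝ × ℝ => (p.1 - x₀, p.2)) (x₀, 0) :=
    (analyticAt_fst.sub analyticAt_const).prod analyticAt_snd
  have h0 := analyticAt_tsum_evalAt hA hB hc
  have h2 := AnalyticAt.fun_comp (f := fun p : ℝ × ℝ => (p.1 - x₀, p.2)) (x := (x₀, (0 : ℝ)))
    (by rw [sub_self]; exact h0) h1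
  refine h2.congr ?_
  have ho : IsOpen {p : ℝ × ℝ | |p.1 - x₀| < A⁻¹} := isOpen_lt (by fun_prop) continuous_const
  filter_upwards [ho.mem_nhds (by simpa using hA)] with p hp
  refine tsum_congr fun n => ?_
  rw [← hg n _ hp, add_sub_cancel]

/-- Termwise partial derivatives of `∑ gₙ(x) tⁿ`, expressed by the power series in `t` whose
coefficients are `gₙ(x)` and `gₙ'(x)`. -/
theorem pd_tsum_of_expansion {g : ℕ → ℝ → ℝ} {x₀ C A B : ℝ} {c : ℕ → ℝ⟦X⟧}
    (hA : 0 < A) (hB : 0 < B) (hc : ∀ n m, |coeff m (c n)| ≤ C * B ^ n * A ^ m)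
    (hg : ∀ n h, |h| < A⁻¹ → g n (x₀ + h) = evalAt h (c n)) {p : ℝ × ℝ}
    (hp : |p.1 - x₀| < (4 * A)⁻¹ ∧ |p.2| < B⁻¹) :
    ConvergesOn B⁻¹ (PowerSeries.mk fun n => g n p.1) ∧
      ConvergesOn B⁻¹ (PowerSeries.mk fun n => deriv (g n) p.1) ∧
      pd₁ (fun p : ℝ × ℝ => ∑' n, g n p.1 * p.2 ^ n) p =
        evalAt p.2 (PowerSeries.mk fun n => deriv (g n) p.1) ∧
      pd₂ (fun p : ℝ × ℝ => ∑' n, g n p.1 * p.2 ^ n) p =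
        evalAt p.2 (d⁄dX ℝ (PowerSeries.mk fun n => g n p.1)) := by
  have hconv : ∀ n, ConvergesOn A⁻¹ (c n) := fun n => .of_bound hA (hc n)
  have hlt : ∀ {x : ℝ}, |x - x₀| < (4 * A)⁻¹ → |x - x₀| < A⁻¹ := fun hx => hx.trans_le <| by
    gcongr
    linarith
  have hder : ∀ n x, |x - x₀| < (4 * A)⁻¹ →
      HasDerivAt (g n) (evalAt (x - x₀) (d⁄dX ℝ (c n))) x := fun n x hx => by
    have := hasDerivAt_of_eq_evalAt (hconv n) (hg n) (hlt hx)
    rwa [add_sub_cancel] at this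
  have hgb : ∀ n x, |x - x₀| < (4 * A)⁻¹ → |g n x| ≤ 2 * C * B ^ n := fun n x hx => by
    have h1 := hg n (x - x₀) (hlt hx)
    rw [add_sub_cancel] at h1
    rw [h1, mul_assoc]
    refine abs_evalAt_le hA (hc n) (hx.le.trans ?_)
    gcongr
    linarith
  have hdb : ∀ n x, |x - x₀| < (4 * A)⁻¹ → |deriv (g n) x| ≤ 2 * C * A * B ^ n := fun n x hx => by
    rw [(hder n x hx).deriv]
    refine (abs_evalAt_le (by positivity) (abs_coeff_derivative_le hA (hc n)) ?_).trans_eq (by ring)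
    exact hx.le.trans_eq (by ring_nf)
  have hC1 : ConvergesOn B⁻¹ (PowerSeries.mk fun n => g n p.1) :=
    .of_bound hB fun n => by rw [coeff_mk]; exact hgb n _ hp.1
  have hC2 : ConvergesOn B⁻¹ (PowerSeries.mk fun n => deriv (g n) p.1) :=
    .of_bound hB fun n => by rw [coeff_mk]; exact hdb n _ hp.1
  refine ⟨hC1, hC2, ?_, ?_⟩
  · have hball : ∀ {x : ℝ}, x ∈ Metric.ball x₀ (4 * A)⁻¹ ↔ |x - x₀| < (4 * A)⁻¹ := by
      intro x
      rw [Metric.mem_ball, Real.dist_eq]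
    have hs : Summable fun n => 2 * C * A * (B * |p.2|) ^ n := by
      refine (summable_geometric_of_lt_one (by positivity) ?_).mul_left _
      have := mul_lt_mul_of_pos_left hp.2 hB
      rwa [mul_inv_cancel₀ hB.ne'] at this
    have hsum0 : Summable fun n => g n p.1 * p.2 ^ n := by
      simpa using (hC1.hasSum hp.2).summable
    have := hasDerivAt_tsum_of_isPreconnected (F := ℝ) (g := fun n s => g n s * p.2 ^ n)
      (g' := fun n s => deriv (g n) s * p.2 ^ n) (t := Metric.ball x₀ (4 * A)⁻¹) (y₀ := p.1)
      (y := p.1) hs Metric.isOpen_ball (convex_ball _ _).isPreconnected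
      (fun n y hy => (hder n y (hball.1 hy)).differentiableAt.hasDerivAt.mul_const _)
      (fun n y hy => by
        rw [norm_mul, norm_pow, Real.norm_eq_abs, Real.norm_eq_abs, mul_pow, ← mul_assoc]
        exact mul_le_mul_of_nonneg_right (hdb n y (hball.1 hy)) (by positivity))
      (hball.2 hp.1) hsum0 (hball.2 hp.1)
    rw [pd₁, this.deriv, evalAt]
    simp
  · have := hasDerivAt_evalAt hC1 hp.2
    rw [pd₂, ← this.deriv]
    simp [evalAt]

/-- Local existence in the Cauchy–Kovalevskaya theorem for the dispersionless focusing NLS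
system. -/
theorem cauchy_local {uI vI : ℝ → ℝ} {x₀ : ℝ} (hu : AnalyticAt ℝ uI x₀)
    (hv : AnalyticAt ℝ vI x₀) :
    AnalyticAt ℝ (cauchyU uI vI) (x₀, 0) ∧ AnalyticAt ℝ (cauchyV uI vI) (x₀, 0) ∧
      ∀ᶠ p in 𝓝 (x₀, (0 : ℝ)),
        (pd₂ (cauchyU uI vI) p + cauchyV uI vI p * pd₁ (cauchyU uI vI) p +
          cauchyU uI vI p * pd₁ (cauchyV uI vI) p = 0) ∧
        (pd₂ (cauchyV uI vI) p - pd₁ (cauchyU uI vI) p +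
          cauchyV uI vI p * pd₁ (cauchyV uI vI) p = 0) := by
  obtain ⟨C, A, B, c, d, hA, hB, hc, hd, he⟩ := exists_expansion_timeCoeff hu hv
  have heu := fun n h hh => (he n h hh).1
  have hev := fun n h hh => (he n h hh).2
  refine ⟨analyticAt_tsum_of_expansion hA hB hc heu, analyticAt_tsum_of_expansion hA hB hd hev, ?_⟩
  have ho : IsOpen {p : ℝ × ℝ | |p.1 - x₀| < (4 * A)⁻¹ ∧ |p.2| < B⁻¹} :=
    (isOpen_lt (f := fun p : ℝ × ℝ => |p.1 - x₀|) (by fun_prop) continuous_const).inter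
      (isOpen_lt (f := fun p : ℝ × ℝ => |p.2|) (by fun_prop) continuous_const)
  filter_upwards [ho.mem_nhds (by simp [hA, hB])] with p hp
  obtain ⟨cu, cu', hu₁, hu₂⟩ := pd_tsum_of_expansion hA hB hc heu hp
  obtain ⟨cv, cv', hv₁, hv₂⟩ := pd_tsum_of_expansion hA hB hd hev hp
  set U : ℝ⟦X⟧ := PowerSeries.mk fun n => (timeCoeff deriv (uI, vI) n).1 p.1 with hU
  set V : ℝ⟦X⟧ := PowerSeries.mk fun n => (timeCoeff deriv (uI, vI) n).2 p.1 with hV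
  set U' : ℝ⟦X⟧ := PowerSeries.mk fun n => deriv (timeCoeff deriv (uI, vI) n).1 p.1 with hU'
  set V' : ℝ⟦X⟧ := PowerSeries.mk fun n => deriv (timeCoeff deriv (uI, vI) n).2 p.1 with hV'
  have eu : cauchyU uI vI p = evalAt p.2 U := by simp [cauchyU, evalAt, hU]
  have ev : cauchyV uI vI p = evalAt p.2 V := by simp [cauchyV, evalAt, hV]
  -- The recursion for the coefficients is the system, read in the ring of power series in `t`.
  have e1 : d⁄dX ℝ U = -(V * U' + U * V') := by
    ext n
    have hn : (n + 1 : ℝ) ≠ 0 := by positivity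
    rw [coeff_derivative, map_neg, map_add, coeff_mul, coeff_mul, ← Finset.sum_add_distrib]
    simp only [hU, hV, hU', hV', coeff_mk, timeCoeff_succ_fst, Pi.smul_apply, Pi.neg_apply,
      Finset.sum_apply, Pi.add_apply, Pi.mul_apply, smul_eq_mul]
    field_simp
  have e2 : d⁄dX ℝ V = U' - V * V' := by
    ext n
    have hn : (n + 1 : ℝ) ≠ 0 := by positivity
    rw [coeff_derivative, map_sub, coeff_mul]
    simp only [hV, hU', hV', coeff_mk, timeCoeff_succ_snd, Pi.smul_apply, Pi.sub_apply,
      Finset.sum_apply, Pi.mul_apply, smul_eq_mul]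
    field_simp
  change pd₁ (cauchyU uI vI) p = _ at hu₁
  change pd₂ (cauchyU uI vI) p = _ at hu₂
  change pd₁ (cauchyV uI vI) p = _ at hv₁
  change pd₂ (cauchyV uI vI) p = _ at hv₂
  rw [hu₁, hu₂, hv₁, hv₂, eu, ev, e1, e2, evalAt_neg, evalAt_add (cv.mul cu') (cu.mul cv') hp.2,
    evalAt_sub cu' (cv.mul cv') hp.2, evalAt_mul cv cu' hp.2, evalAt_mul cu cv' hp.2,
    evalAt_mul cv cv' hp.2]
  constructor <;> ring

end PowerSeriesInTime

open Filter Topology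
open scoped ContDiff

/-! ### Partial derivatives -/

section pd

variable {g h : ℝ × ℝ → ℝ} {p : ℝ × ℝ}

theorem hasDerivAt_pd₁ (hg : DifferentiableAt ℝ g p) :
    HasDerivAt (fun s => g (s, p.2)) (pd₁ g p) p.1 := by
  have : DifferentiableAt ℝ (fun s : ℝ => g (s, p.2)) p.1 :=
    DifferentiableAt.comp (f := fun s : ℝ => (s, p.2)) p.1 hg (by fun_prop)
  exact this.hasDerivAt

theorem hasDerivAt_pd₂ (hg : DifferentiableAt ℝ g p) :
    HasDerivAt (fun s => g (p.1, s)) (pd₂ g p) p.2 := by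
  have : DifferentiableAt ℝ (fun s : ℝ => g (p.1, s)) p.2 :=
    DifferentiableAt.comp (f := fun s : ℝ => (p.1, s)) p.2 hg (by fun_prop)
  exact this.hasDerivAt

theorem pd₁_eq_of_hasFDerivAt {L : ℝ × ℝ →L[ℝ] ℝ} (hg : HasFDerivAt g L p) :
    pd₁ g p = L (1, 0) := by
  have h1 : HasDerivAt (fun s : ℝ => (s, p.2)) ((1 : ℝ), (0 : ℝ)) p.1 :=
    (hasDerivAt_id p.1).prodMk (hasDerivAt_const _ _)
  exact (HasFDerivAt.comp_hasDerivAt (f := fun s : ℝ => (s, p.2)) p.1 hg h1).deriv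

theorem pd₂_eq_of_hasFDerivAt {L : ℝ × ℝ →L[ℝ] ℝ} (hg : HasFDerivAt g L p) :
    pd₂ g p = L (0, 1) := by
  have h1 : HasDerivAt (fun s : ℝ => (p.1, s)) ((0 : ℝ), (1 : ℝ)) p.2 :=
    (hasDerivAt_const _ _).prodMk (hasDerivAt_id p.2)
  exact (HasFDerivAt.comp_hasDerivAt (f := fun s : ℝ => (p.1, s)) p.2 hg h1).deriv

theorem hasFDerivAt_pd (hg : DifferentiableAt ℝ g p) :
    HasFDerivAt g (pd₁ g p • ContinuousLinearMap.fst ℝ ℝ ℝ +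
      pd₂ g p • ContinuousLinearMap.snd ℝ ℝ ℝ) p := by
  have h1 := hg.hasFDerivAt
  convert! h1 using 1
  rw [pd₁_eq_of_hasFDerivAt h1, pd₂_eq_of_hasFDerivAt h1]
  ext <;> simp

theorem pd₁_congr (hgh : g =ᶠ[𝓝 p] h) : pd₁ g p = pd₁ h p := by
  refine Filter.EventuallyEq.deriv_eq ?_
  have : ContinuousAt (fun s : ℝ => (s, p.2)) p.1 := by fun_prop
  exact this.eventually hgh

theorem pd₂_congr (hgh : g =ᶠ[𝓝 p] h) : pd₂ g p = pd₂ h p := by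
  refine Filter.EventuallyEq.deriv_eq ?_
  have : ContinuousAt (fun s : ℝ => (p.1, s)) p.2 := by fun_prop
  exact this.eventually hgh

theorem pd₁_eventuallyEq_fderiv {n : WithTop ℕ∞} (hn : 1 ≤ n)
    (hg : ∀ᶠ q in 𝓝 p, ContDiffAt ℝ n g q) :
    pd₁ g =ᶠ[𝓝 p] fun q => fderiv ℝ g q (1, 0) := by
  filter_upwards [hg] with q hq
  exact pd₁_eq_of_hasFDerivAt (hq.differentiableAt (by positivity)).hasFDerivAt

theorem pd₂_eventuallyEq_fderiv {n : WithTop ℕ∞} (hn : 1 ≤ n)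
    (hg : ∀ᶠ q in 𝓝 p, ContDiffAt ℝ n g q) :
    pd₂ g =ᶠ[𝓝 p] fun q => fderiv ℝ g q (0, 1) := by
  filter_upwards [hg] with q hq
  exact pd₂_eq_of_hasFDerivAt (hq.differentiableAt (by positivity)).hasFDerivAt

theorem contDiffAt_pd₁ {m n : WithTop ℕ∞} (hmn : m + 1 ≤ n)
    (hg : ∀ᶠ q in 𝓝 p, ContDiffAt ℝ n g q) :
    ContDiffAt ℝ m (pd₁ g) p :=
  ((hg.self_of_nhds.fderiv_right hmn).clm_apply contDiffAt_const).congr_of_eventuallyEq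
    (pd₁_eventuallyEq_fderiv (le_add_self.trans hmn) hg)

theorem contDiffAt_pd₂ {m n : WithTop ℕ∞} (hmn : m + 1 ≤ n)
    (hg : ∀ᶠ q in 𝓝 p, ContDiffAt ℝ n g q) :
    ContDiffAt ℝ m (pd₂ g) p :=
  ((hg.self_of_nhds.fderiv_right hmn).clm_apply contDiffAt_const).congr_of_eventuallyEq
    (pd₂_eventuallyEq_fderiv (le_add_self.trans hmn) hg)

theorem pd₁_pd₂_comm (hg : ∀ᶠ q in 𝓝 p, ContDiffAt ℝ 2 g q) :
    pd₁ (pd₂ g) p = pd₂ (pd₁ g) p := by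
  have h2 : (1 : WithTop ℕ∞) ≤ 2 := by norm_num
  have hd : DifferentiableAt ℝ (fderiv ℝ g) p :=
    (hg.self_of_nhds.fderiv_right (m := 1) (by norm_num)).differentiableAt one_ne_zero
  have hsymm := hg.self_of_nhds.isSymmSndFDerivAt (by simp)
  rw [pd₁_congr (pd₂_eventuallyEq_fderiv h2 hg), pd₂_congr (pd₁_eventuallyEq_fderiv h2 hg),
    pd₁_eq_of_hasFDerivAt (hd.hasFDerivAt.clm_apply (hasFDerivAt_const _ _)),
    pd₂_eq_of_hasFDerivAt (hd.hasFDerivAt.clm_apply (hasFDerivAt_const _ _))]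
  simpa using hsymm (1, 0) (0, 1)

theorem eventually_contDiffAt {n : WithTop ℕ∞} (hg : AnalyticAt ℝ g p) :
    ∀ᶠ q in 𝓝 p, ContDiffAt ℝ n g q :=
  hg.eventually_analyticAt.mono fun _ hq => hq.contDiffAt

theorem analyticAt_pd₁ (hg : AnalyticAt ℝ g p) : AnalyticAt ℝ (pd₁ g) p :=
  (contDiffAt_pd₁ (m := ω) (n := ω) le_rfl (eventually_contDiffAt hg)).analyticAt

theorem analyticAt_pd₂ (hg : AnalyticAt ℝ g p) : AnalyticAt ℝ (pd₂ g) p :=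
  (contDiffAt_pd₂ (m := ω) (n := ω) le_rfl (eventually_contDiffAt hg)).analyticAt

theorem pd₁_add (hg : DifferentiableAt ℝ g p) (hh : DifferentiableAt ℝ h p) :
    pd₁ (g + h) p = pd₁ g p + pd₁ h p :=
  ((hasDerivAt_pd₁ hg).add (hasDerivAt_pd₁ hh)).deriv

theorem pd₁_sub (hg : DifferentiableAt ℝ g p) (hh : DifferentiableAt ℝ h p) :
    pd₁ (g - h) p = pd₁ g p - pd₁ h p :=
  ((hasDerivAt_pd₁ hg).sub (hasDerivAt_pd₁ hh)).deriv

theorem pd₁_mul (hg : DifferentiableAt ℝ g p) (hh : DifferentiableAt ℝ h p) :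
    pd₁ (g * h) p = pd₁ g p * h p + g p * pd₁ h p :=
  ((hasDerivAt_pd₁ hg).mul (hasDerivAt_pd₁ hh)).deriv

theorem pd₂_add (hg : DifferentiableAt ℝ g p) (hh : DifferentiableAt ℝ h p) :
    pd₂ (g + h) p = pd₂ g p + pd₂ h p :=
  ((hasDerivAt_pd₂ hg).add (hasDerivAt_pd₂ hh)).deriv

theorem pd₂_sub (hg : DifferentiableAt ℝ g p) (hh : DifferentiableAt ℝ h p) :
    pd₂ (g - h) p = pd₂ g p - pd₂ h p :=
  ((hasDerivAt_pd₂ hg).sub (hasDerivAt_pd₂ hh)).deriv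

theorem pd₂_mul (hg : DifferentiableAt ℝ g p) (hh : DifferentiableAt ℝ h p) :
    pd₂ (g * h) p = pd₂ g p * h p + g p * pd₂ h p :=
  ((hasDerivAt_pd₂ hg).mul (hasDerivAt_pd₂ hh)).deriv

end pd

/-! ### Uniqueness in the Cauchy problem -/

/-- `g` vanishes to order at least `k` on `t = 0`: on the part of the line `t = 0` that lies in `W`,
the derivatives of `g` of order `< k` in `t` are zero. -/
def VanishesToOrder (W : Set (ℝ × ℝ)) : ℕ → (ℝ × ℝ → ℝ) → Prop
  | 0, _ => True
  | k + 1, g => (∀ x, (x, 0) ∈ W → g (x, 0) = 0) ∧ VanishesToOrder W k (pd₂ g)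

namespace VanishesToOrder

variable {W : Set (ℝ × ℝ)} {k : ℕ} {g h : ℝ × ℝ → ℝ}

theorem congr (hW : IsOpen W) (hg : VanishesToOrder W k g) (hgh : EqOn g h W) :
    VanishesToOrder W k h := by
  induction k generalizing g h with
  | zero => trivial
  | succ k ih =>
    refine ⟨fun x hx => (hgh hx).symm.trans (hg.1 x hx), ih hg.2 fun q hq => ?_⟩
    exact pd₂_congr (hgh.eventuallyEq_of_mem (hW.mem_nhds hq))

theorem of_succ (hg : VanishesToOrder W (k + 1) g) : VanishesToOrder W k g := by
  induction k generalizing g with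
  | zero => trivial
  | succ k ih => exact ⟨hg.1, ih hg.2⟩

theorem add (hW : IsOpen W) (hga : AnalyticOnNhd ℝ g W) (hha : AnalyticOnNhd ℝ h W)
    (hg : VanishesToOrder W k g) (hh : VanishesToOrder W k h) : VanishesToOrder W k (g + h) := by
  induction k generalizing g h with
  | zero => trivial
  | succ k ih =>
    refine ⟨fun x hx => by simp [hg.1 x hx, hh.1 x hx], ?_⟩
    refine congr hW (ih (fun q hq => analyticAt_pd₂ (hga q hq))
      (fun q hq => analyticAt_pd₂ (hha q hq)) hg.2 hh.2) fun q hq => ?_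
    exact (pd₂_add (hga q hq).differentiableAt (hha q hq).differentiableAt).symm

theorem mul_left (hW : IsOpen W) (hha : AnalyticOnNhd ℝ h W) (hga : AnalyticOnNhd ℝ g W)
    (hg : VanishesToOrder W k g) : VanishesToOrder W k (h * g) := by
  induction k generalizing g h with
  | zero => trivial
  | succ k ih =>
    refine ⟨fun x hx => by simp [hg.1 x hx], ?_⟩
    have hha' : AnalyticOnNhd ℝ (pd₂ h) W := fun q hq => analyticAt_pd₂ (hha q hq)
    have hga' : AnalyticOnNhd ℝ (pd₂ g) W := fun q hq => analyticAt_pd₂ (hga q hq)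
    refine congr hW (add hW (hha'.mul hga) (hha.mul hga') (ih hha' hga hg.of_succ)
      (ih hha hga' hg.2)) fun q hq => ?_
    exact (pd₂_mul (hha q hq).differentiableAt (hga q hq).differentiableAt).symm

theorem pd₁ (hW : IsOpen W) (hga : AnalyticOnNhd ℝ g W) (hg : VanishesToOrder W k g) :
    VanishesToOrder W k (pd₁ g) := by
  induction k generalizing g with
  | zero => trivial
  | succ k ih =>
    refine ⟨fun x hx => ?_, ?_⟩
    · have hc : ContinuousAt (fun s : ℝ => (s, (0 : ℝ))) x := by fun_prop
      have h0 : (fun s => g (s, 0)) =ᶠ[𝓝 x] fun _ => 0 := by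
        filter_upwards [hc.eventually (hW.mem_nhds hx)] with s hs using hg.1 s hs
      exact h0.deriv_eq.trans (deriv_const _ _)
    · exact congr hW (ih (fun q hq => analyticAt_pd₂ (hga q hq)) hg.2) fun q hq =>
        pd₁_pd₂_comm (eventually_contDiffAt (hga q hq))

theorem iterate_pd₂_eq_zero (hg : VanishesToOrder W (k + 1) g) {x : ℝ} (hx : (x, 0) ∈ W) :
    pd₂^[k] g (x, 0) = 0 := by
  induction k generalizing g with
  | zero => exact hg.1 x hx
  | succ k ih => exact ih hg.2

end VanishesToOrder

theorem iteratedDeriv_slice (g : ℝ × ℝ → ℝ) (x : ℝ) (k : ℕ) :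
    iteratedDeriv k (fun τ => g (x, τ)) = fun τ => pd₂^[k] g (x, τ) := by
  induction k with
  | zero => simp
  | succ k ih =>
    rw [iteratedDeriv_succ, ih]
    funext τ
    rw [Function.iterate_succ_apply']
    rfl

theorem eq_zero_of_vanishesToOrder {α β δ : ℝ} {g : ℝ × ℝ → ℝ}
    (hga : AnalyticOnNhd ℝ g (Ioo α β ×ˢ Ioo (-δ) δ))
    (hg : ∀ k, VanishesToOrder (Ioo α β ×ˢ Ioo (-δ) δ) k g) :
    EqOn g 0 (Ioo α β ×ˢ Ioo (-δ) δ) := by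
  rintro ⟨x, t⟩ ⟨hx, ht⟩
  have hδ : (0 : ℝ) ∈ Ioo (-δ) δ := by
    have := ht.1.trans ht.2
    constructor <;> linarith
  have hs : AnalyticOnNhd ℝ (fun τ => g (x, τ)) (Ioo (-δ) δ) := fun τ hτ =>
    (hga (x, τ) ⟨hx, hτ⟩).fun_comp (f := fun τ : ℝ => (x, τ)) (analyticAt_const.prod analyticAt_id)
  have h0 : ∀ᶠ τ in 𝓝 (0 : ℝ), g (x, τ) = 0 := by
    have hp := (hs 0 hδ).hasFPowerSeriesAt
    have hz : (fun n => iteratedDeriv n (fun τ => g (x, τ)) 0 / (n.factorial : ℝ)) = 0 := by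
      funext n
      rw [iteratedDeriv_slice]
      simp [(hg (n + 1)).iterate_pd₂_eq_zero ⟨hx, hδ⟩]
    rw [hz, (FormalMultilinearSeries.ofScalars_series_eq_zero ℝ).2 rfl] at hp
    exact hp.eventually_eq_zero
  exact hs.eqOn_zero_of_preconnected_of_eventuallyEq_zero isPreconnected_Ioo hδ h0 ht

/-- Two analytic solutions with the same initial values agree: the differences satisfy a linear
homogeneous system, so that vanishing to order `k` on `t = 0` improves to order `k + 1`. -/
theorem cauchy_unique {α β δ : ℝ} {u v u' v' : ℝ × ℝ → ℝ}
    (hu : AnalyticOnNhd ℝ u (Ioo α β ×ˢ Ioo (-δ) δ))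
    (hv : AnalyticOnNhd ℝ v (Ioo α β ×ˢ Ioo (-δ) δ))
    (hu' : AnalyticOnNhd ℝ u' (Ioo α β ×ˢ Ioo (-δ) δ))
    (hv' : AnalyticOnNhd ℝ v' (Ioo α β ×ˢ Ioo (-δ) δ))
    (hs : IsSolution u v (Ioo α β ×ˢ Ioo (-δ) δ)) (hs' : IsSolution u' v' (Ioo α β ×ˢ Ioo (-δ) δ))
    (h0 : ∀ x ∈ Ioo α β, u' (x, 0) = u (x, 0) ∧ v' (x, 0) = v (x, 0)) :
    EqOn u' u (Ioo α β ×ˢ Ioo (-δ) δ) ∧ EqOn v' v (Ioo α β ×ˢ Ioo (-δ) δ) := by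
  set W := Ioo α β ×ˢ Ioo (-δ) δ with hWdef
  have hW : IsOpen W := isOpen_Ioo.prod isOpen_Ioo
  have hd : AnalyticOnNhd ℝ (u' - u) W := hu'.sub hu
  have he : AnalyticOnNhd ℝ (v' - v) W := hv'.sub hv
  have hpd : ∀ {g}, AnalyticOnNhd ℝ g W → AnalyticOnNhd ℝ (pd₁ g) W :=
    fun hg q hq => analyticAt_pd₁ (hg q hq)
  have key : ∀ k, VanishesToOrder W k (u' - u) ∧ VanishesToOrder W k (v' - v) := by
    intro k
    induction k with
    | zero => exact ⟨trivial, trivial⟩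
    | succ k ih =>
      obtain ⟨ihd, ihe⟩ := ih
      have m1 : AnalyticOnNhd ℝ (-1 : ℝ × ℝ → ℝ) W := fun _ _ => analyticAt_const (v := (-1 : ℝ))
      have a1 := hv'.mul (hpd hd)
      have a2 := (hpd hu).mul he
      have a3 := hu'.mul (hpd he)
      have a4 := (hpd hv).mul hd
      have a5 := hv'.mul (hpd he)
      have a6 := (hpd hv).mul he
      refine ⟨⟨fun x hx => by simp [(h0 x hx.1).1], ?_⟩, ⟨fun x hx => by simp [(h0 x hx.1).2], ?_⟩⟩
      · refine .congr hW (.mul_left hW m1 (((a1.add a2).add a3).add a4)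
          (.add hW ((a1.add a2).add a3) a4 (.add hW (a1.add a2) a3 (.add hW a1 a2
            (.mul_left hW hv' (hpd hd) (.pd₁ hW hd ihd)) (.mul_left hW (hpd hu) he ihe))
            (.mul_left hW hu' (hpd he) (.pd₁ hW he ihe))) (.mul_left hW (hpd hv) hd ihd)))
          fun q hq => ?_
        have e1 := hs.eq_u q hq
        have e2 := hs'.eq_u q hq
        have du := (hu q hq).differentiableAt
        have dv := (hv q hq).differentiableAt
        have du' := (hu' q hq).differentiableAt
        have dv' := (hv' q hq).differentiableAt
        simp only [Pi.mul_apply, Pi.add_apply, Pi.sub_apply, Pi.neg_apply, Pi.one_apply,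
          pd₁_sub du' du, pd₁_sub dv' dv, pd₂_sub du' du]
        linear_combination e1 - e2
      · refine .congr hW (.add hW (hpd hd) (m1.mul (a5.add a6)) (.pd₁ hW hd ihd)
          (.mul_left hW m1 (a5.add a6) (.add hW a5 a6
            (.mul_left hW hv' (hpd he) (.pd₁ hW he ihe)) (.mul_left hW (hpd hv) he ihe))))
          fun q hq => ?_
        have e1 := hs.eq_v q hq
        have e2 := hs'.eq_v q hq
        have du := (hu q hq).differentiableAt
        have dv := (hv q hq).differentiableAt
        have du' := (hu' q hq).differentiableAt
        have dv' := (hv' q hq).differentiableAt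
        simp only [Pi.add_apply, Pi.sub_apply, Pi.neg_apply, Pi.one_apply,
          pd₁_sub du' du, pd₁_sub dv' dv, pd₂_sub dv' dv]
        linear_combination e1 - e2
  constructor
  · intro q hq
    exact sub_eq_zero.1 (eq_zero_of_vanishesToOrder hd (fun k => (key k).1) hq)
  · intro q hq
    exact sub_eq_zero.1 (eq_zero_of_vanishesToOrder he (fun k => (key k).2) hq)

/-! ### Primitives of analytic one-forms -/

/-- The Taylor series of the primitive, zero at the base point, of a closed one-form with Taylor
series `q`. -/
noncomputable def primitiveSeries {E F : Type*} [NormedAddCommGroup E] [NormedSpace ℝ E]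
    [NormedAddCommGroup F] [NormedSpace ℝ F] (q : FormalMultilinearSeries ℝ E (E →L[ℝ] F)) :
    FormalMultilinearSeries ℝ E F
  | 0 => 0
  | n + 1 => (n + 1 : ℝ)⁻¹ • (q n).uncurryRight

theorem norm_primitiveSeries_succ_le {E F : Type*} [NormedAddCommGroup E] [NormedSpace ℝ E]
    [NormedAddCommGroup F] [NormedSpace ℝ F] (q : FormalMultilinearSeries ℝ E (E →L[ℝ] F)) (n : ℕ) :
    ‖primitiveSeries q (n + 1)‖ ≤ ‖q n‖ := by
  have h0 : (0 : ℝ) ≤ n := n.cast_nonneg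
  have h1 : ‖(n + 1 : ℝ)⁻¹‖ ≤ 1 := by
    rw [norm_inv, Real.norm_of_nonneg (by positivity)]
    exact inv_le_one_of_one_le₀ (by linarith)
  rw [primitiveSeries, norm_smul, ContinuousMultilinearMap.uncurryRight_norm]
  exact mul_le_of_le_one_left (norm_nonneg (q n)) h1

/-- A function whose derivative is analytic at a point is itself analytic there: its Taylor series
is obtained by integrating the series of the derivative along rays. -/
theorem analyticAt_of_hasFDerivAt {E F : Type*} [NormedAddCommGroup E] [NormedSpace ℝ E]
    [NormedAddCommGroup F] [NormedSpace ℝ F] [CompleteSpace F] {f : E → F} {f' : E → E →L[ℝ] F}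
    {x : E} (hf : ∀ᶠ y in 𝓝 x, HasFDerivAt f (f' y) y) (hf' : AnalyticAt ℝ f' x) :
    AnalyticAt ℝ f x := by
  obtain ⟨q, r, hq⟩ := hf'
  obtain ⟨ε, hε, hfε⟩ := Metric.eventually_nhds_iff.1 hf
  obtain ⟨s, hs0, hsr⟩ := ENNReal.lt_iff_exists_nnreal_btwn.1
    (lt_min hq.r_pos (ENNReal.ofReal_pos.2 hε))
  have hs0' : 0 < s := by exact_mod_cast hs0
  have hsr1 : (s : ENNReal) < r := hsr.trans_le (min_le_left _ _)
  have hsε : (s : ℝ) < ε := by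
    have := hsr.trans_le (min_le_right _ _)
    rw [ENNReal.ofReal, ENNReal.coe_lt_coe] at this
    exact Real.lt_toNNReal_iff_coe_lt.1 this
  obtain ⟨C, hC, hCb⟩ := q.norm_mul_pow_le_of_lt_radius (hsr1.trans_le hq.r_le)
  set p := primitiveSeries q with hp
  have hpr : (s : ENNReal) ≤ p.radius := by
    refine p.le_radius_of_bound (C * s) fun n => ?_
    rcases n with _ | n
    · simp only [p, primitiveSeries, norm_zero, zero_mul]
      positivity
    · calc ‖p (n + 1)‖ * (s : ℝ) ^ (n + 1) ≤ ‖q n‖ * (s : ℝ) ^ (n + 1) := by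
            gcongr
            exact norm_primitiveSeries_succ_le q n
        _ = ‖q n‖ * (s : ℝ) ^ n * s := by ring
        _ ≤ C * s := by gcongr; exact hCb n
  have hmain : HasFPowerSeriesOnBall (fun y => f y - f x) p x s := by
    refine ⟨hpr, hs0, fun {y} hy => ?_⟩
    have hys : ‖y‖ < s := by
      rw [Metric.mem_eball, edist_zero_right, enorm_eq_nnnorm, ENNReal.coe_lt_coe] at hy
      exact_mod_cast hy
    -- Some room beyond the unit interval, to differentiate on an open interval containing `0`, `1`.
    obtain ⟨ρ, hρ1, hρ⟩ : ∃ ρ : ℝ, 1 < ρ ∧ ρ * ‖y‖ < s := by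
      have hc : ContinuousAt (fun ρ : ℝ => ρ * ‖y‖) 1 := by fun_prop
      have h1 : ∀ᶠ ρ in 𝓝[>] (1 : ℝ), ρ * ‖y‖ < s :=
        (hc.eventually (gt_mem_nhds (by simpa using hys))).filter_mono nhdsWithin_le_nhds
      obtain ⟨ρ, h2, h3⟩ := (h1.and self_mem_nhdsWithin).exists
      exact ⟨ρ, h3, h2⟩
    have hρ0 : 0 < ρ := by linarith
    have hball : ∀ τ ∈ Ioo (-ρ) ρ, ‖τ • y‖ < s := fun τ hτ => by
      rw [norm_smul, Real.norm_eq_abs]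
      exact lt_of_le_of_lt (by gcongr; exact (abs_lt.2 hτ).le) hρ
    let a : ℕ → F := fun n => q n (fun _ => y) y
    have hsum : Summable fun n => ‖ρ ^ n • a n‖ := by
      have hmem : ρ • y ∈ Metric.eball (0 : E) q.radius := by
        rw [Metric.mem_eball, edist_zero_right, enorm_eq_nnnorm]
        refine lt_of_lt_of_le ?_ (hsr1.le.trans hq.r_le)
        rw [ENNReal.coe_lt_coe, ← NNReal.coe_lt_coe, coe_nnnorm, norm_smul,
          Real.norm_of_nonneg hρ0.le]
        exact hρ
      refine ((q.summable_norm_apply hmem).mul_right ‖y‖).of_nonneg_of_le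
        (fun n => norm_nonneg _) fun n => ?_
      rw [(q n).map_smul_univ (fun _ => ρ) fun _ => y]
      simp only [Finset.prod_const, Finset.card_univ, Fintype.card_fin]
      rw [norm_smul, norm_smul, mul_assoc]
      gcongr
      exact ContinuousLinearMap.le_opNorm _ _
    have hS : ∀ τ ∈ Ioo (-ρ) ρ, HasDerivAt
        (fun τ : ℝ => ∑' n : ℕ, (τ ^ (n + 1) * (n + 1 : ℝ)⁻¹) • a n) (∑' n, τ ^ n • a n) τ := by
      intro τ hτ
      refine hasDerivAt_tsum_of_isPreconnected (F := F)
        (g := fun (n : ℕ) (τ : ℝ) => (τ ^ (n + 1) * (n + 1 : ℝ)⁻¹) • a n)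
        (g' := fun n τ => τ ^ n • a n) (t := Ioo (-ρ) ρ) (y₀ := 0) hsum isOpen_Ioo
        isPreconnected_Ioo ?_ ?_ ⟨by linarith, hρ0⟩ ?_ hτ
      · intro n z _
        have := ((hasDerivAt_pow (n + 1) z).mul_const ((n + 1 : ℝ)⁻¹)).smul_const (a n)
        convert! this using 2
        push_cast
        have : (n + 1 : ℝ) ≠ 0 := by positivity
        rw [mul_right_comm, mul_inv_cancel₀ this, one_mul]
      · intro n z hz
        rw [norm_smul, norm_smul, norm_pow, norm_pow]
        gcongr
        rw [Real.norm_of_nonneg hρ0.le]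
        exact (abs_lt.2 hz).le
      · simp
    have hfd : ∀ τ ∈ Ioo (-ρ) ρ, HasDerivAt (fun τ : ℝ => f (x + τ • y) - f x)
        (∑' n, τ ^ n • a n) τ := by
      intro τ hτ
      have h1 : HasFDerivAt f (f' (x + τ • y)) (x + τ • y) :=
        hfε (by simpa [dist_eq_norm] using (hball τ hτ).trans hsε)
      have h2 : HasDerivAt (fun τ : ℝ => x + τ • y) y τ := by
        simpa using ((hasDerivAt_id τ).smul_const y).const_add x
      have h3 := (h1.comp_hasDerivAt τ h2).sub_const (f x)
      have hmem : τ • y ∈ Metric.eball (0 : E) r := by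
        rw [Metric.mem_eball, edist_zero_right, enorm_eq_nnnorm]
        refine lt_trans ?_ hsr1
        rw [ENNReal.coe_lt_coe, ← NNReal.coe_lt_coe, coe_nnnorm]
        exact hball τ hτ
      have h4 := (hq.hasSum hmem).mapL (ContinuousLinearMap.apply ℝ F y)
      convert! h3 using 1
      rw [← ContinuousLinearMap.apply_apply y, ← h4.tsum_eq]
      refine tsum_congr fun n => ?_
      rw [(q n).map_smul_univ (fun _ => τ) fun _ => y]
      simp [a]
    have h1mem : (1 : ℝ) ∈ Ioo (-ρ) ρ := ⟨by linarith, hρ1⟩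
    have heq := isOpen_Ioo.eqOn_of_deriv_eq isPreconnected_Ioo
      (fun τ hτ => (hfd τ hτ).differentiableAt.differentiableWithinAt)
      (fun τ hτ => (hS τ hτ).differentiableAt.differentiableWithinAt)
      (fun τ hτ => (hfd τ hτ).deriv.trans (hS τ hτ).deriv.symm)
      (show (0 : ℝ) ∈ Ioo (-ρ) ρ from ⟨by linarith, hρ0⟩) (by simp) h1mem
    have hps : Summable fun n => p n fun _ => y := (p.summable_norm_apply
      (by
        rw [Metric.mem_eball] at hy ⊢
        exact hy.trans_le hpr)).of_norm
    have hval : f (x + y) - f x = ∑' n, p n fun _ => y := by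
      rw [hps.tsum_eq_zero_add]
      simp only [one_smul, one_pow, one_mul] at heq
      rw [heq]
      have h0 : (p 0 fun _ => y) = 0 := by simp [p, primitiveSeries]
      rw [h0, zero_add]
      refine tsum_congr fun n => ?_
      rw [hp, primitiveSeries, smul_apply, ContinuousMultilinearMap.uncurryRight_apply]
      rfl
    rw [hval]
    exact hps.hasSum
  refine (hmain.analyticAt.fun_add (analyticAt_const (v := f x))).congr (.of_forall fun y => ?_)
  simp

/-! ### Inverse functions -/

section inverse

variable {E : Type*} [NormedAddCommGroup E] [NormedSpace ℝ E] [FiniteDimensional ℝ E]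

theorem exists_equiv_hasStrictFDerivAt {f : E → E} {x : E} (hf : ContDiffAt ℝ 1 f x)
    (hd : Function.Injective (fderiv ℝ f x)) :
    ∃ L : E ≃L[ℝ] E, HasStrictFDerivAt f (L : E →L[ℝ] E) x := by
  refine ⟨(LinearEquiv.ofInjectiveEndo (fderiv ℝ f x : E →ₗ[ℝ] E) hd).toContinuousLinearEquiv, ?_⟩
  convert! hf.hasStrictFDerivAt one_ne_zero using 1

theorem exists_injOn_nhds {f : E → E} {x : E} (hf : ContDiffAt ℝ 1 f x)
    (hd : Function.Injective (fderiv ℝ f x)) : ∃ s ∈ 𝓝 x, InjOn f s := by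
  have : CompleteSpace E := FiniteDimensional.complete ℝ E
  obtain ⟨L, hL⟩ := exists_equiv_hasStrictFDerivAt hf hd
  exact ⟨_, (hL.toOpenPartialHomeomorph f).open_source.mem_nhds
    hL.mem_toOpenPartialHomeomorph_source, (hL.toOpenPartialHomeomorph f).injOn⟩

/-- A global form of the inverse function theorem: an injective map with invertible derivatives has
an open image and an inverse that is as smooth as the map. -/
theorem exists_inverse_of_injOn {f : E → E} {U : Set E} (hU : IsOpen U) (hinj : InjOn f U)
    (hf : ∀ x ∈ U, ContDiffAt ℝ 1 f x) (hd : ∀ x ∈ U, Function.Injective (fderiv ℝ f x)) :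
    IsOpen (f '' U) ∧ ∃ g : E → E, (∀ x ∈ U, g (f x) = x) ∧
      ∀ x ∈ U, ∀ n : WithTop ℕ∞, ContDiffAt ℝ n f x → ContDiffAt ℝ n g (f x) := by
  have : CompleteSpace E := FiniteDimensional.complete ℝ E
  rcases isEmpty_or_nonempty U with hne | ⟨⟨x₁, hx₁⟩⟩
  · have := Set.isEmpty_coe_sort.1 hne
    subst this
    exact ⟨by simp, id, by simp, by simp⟩
  have : Nonempty E := ⟨x₁⟩
  have hg : ∀ x ∈ U, Function.invFunOn f U (f x) = x := fun x hx => hinj.leftInvOn_invFunOn hx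
  refine ⟨isOpen_iff_mem_nhds.2 ?_, Function.invFunOn f U, hg, fun x hx n hn => ?_⟩
  · rintro _ ⟨x, hx, rfl⟩
    obtain ⟨L, hL⟩ := exists_equiv_hasStrictFDerivAt (hf x hx) (hd x hx)
    rw [← hL.map_nhds_eq_of_equiv]
    exact image_mem_map (hU.mem_nhds hx)
  · obtain ⟨L, hL⟩ := exists_equiv_hasStrictFDerivAt (hf x hx) (hd x hx)
    set e := hL.toOpenPartialHomeomorph f with he
    have hxs : x ∈ e.source := hL.mem_toOpenPartialHomeomorph_source
    have hxt : f x ∈ e.target := e.map_source hxs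
    have hex : e.symm (f x) = x := e.left_inv hxs
    have hsymm : ContDiffAt ℝ n e.symm (f x) := by
      refine e.contDiffAt_symm (f₀' := L) hxt ?_ ?_
      · rw [hex]
        exact hL.hasFDerivAt
      · rw [hex]
        exact hn
    refine hsymm.congr_of_eventuallyEq ?_
    have hU' : ∀ᶠ y in 𝓝 (f x), e.symm y ∈ U :=
      (e.continuousAt_symm hxt).eventually (by rw [hex]; exact hU.mem_nhds hx)
    filter_upwards [hU', e.open_target.mem_nhds hxt] with y hy hyt
    have : f (e.symm y) = y := e.right_inv hyt
    rw [← hg _ hy, this]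

end inverse

/-! ### Chain rule -/

section chain

variable {f u v : ℝ × ℝ → ℝ} {p : ℝ × ℝ}

theorem pd₁_comp (hf : DifferentiableAt ℝ f (u p, v p)) (hu : DifferentiableAt ℝ u p)
    (hv : DifferentiableAt ℝ v p) :
    pd₁ (fun p => f (u p, v p)) p = pd₁ f (u p, v p) * pd₁ u p + pd₂ f (u p, v p) * pd₁ v p := by
  have := HasFDerivAt.comp_hasDerivAt (f := fun s => (u (s, p.2), v (s, p.2))) p.1
    (hasFDerivAt_pd hf) ((hasDerivAt_pd₁ hu).prodMk (hasDerivAt_pd₁ hv))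
  exact this.deriv.trans (by simp)

theorem pd₂_comp (hf : DifferentiableAt ℝ f (u p, v p)) (hu : DifferentiableAt ℝ u p)
    (hv : DifferentiableAt ℝ v p) :
    pd₂ (fun p => f (u p, v p)) p = pd₁ f (u p, v p) * pd₂ u p + pd₂ f (u p, v p) * pd₂ v p := by
  have := HasFDerivAt.comp_hasDerivAt (f := fun s => (u (p.1, s), v (p.1, s))) p.2
    (hasFDerivAt_pd hf) ((hasDerivAt_pd₂ hu).prodMk (hasDerivAt_pd₂ hv))
  exact this.deriv.trans (by simp)

theorem pd₁_fst : pd₁ Prod.fst p = 1 := by simp [pd₁]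

theorem pd₂_fst : pd₂ Prod.fst p = 0 := by simp [pd₂]

theorem pd₁_snd : pd₁ Prod.snd p = 0 := by simp [pd₁]

theorem pd₂_snd : pd₂ Prod.snd p = 1 := by simp [pd₂]

end chain

/-! ### From the hodograph equations to the system -/

/-- Functions defined implicitly by the hodograph equations solve the system. Differentiating the
hodograph equations in `x` and `t` and eliminating shows that the two left-hand sides of the system
satisfy a homogeneous linear system with determinant `-(u f_uu² + (t + f_uv)²)`. -/
theorem isSolution_of_hodographEq {f u v : ℝ × ℝ → ℝ} {Ω W : Set (ℝ × ℝ)} (hΩ : IsOpen Ω)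
    (hf : ContDiffOn ℝ 2 f Ω) (hlin : SolvesLinearPDE f Ω) (hW : IsOpen W)
    (hu : ContDiffOn ℝ 1 u W) (hv : ContDiffOn ℝ 1 v W) (hmem : ∀ p ∈ W, (u p, v p) ∈ Ω)
    (hod : ∀ p ∈ W, HodographEq f p (u p, v p))
    (hdet : ∀ p ∈ W, u p * pd₁ (pd₁ f) (u p, v p) ^ 2 +
      (p.2 + pd₂ (pd₁ f) (u p, v p)) ^ 2 ≠ 0) :
    IsSolution u v W := by
  have hf2 : ∀ q ∈ Ω, ∀ᶠ q' in 𝓝 q, ContDiffAt ℝ 2 f q' := fun q hq => by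
    filter_upwards [hΩ.mem_nhds hq] with q' hq' using hf.contDiffAt (hΩ.mem_nhds hq')
  have key : ∀ p ∈ W, (pd₂ u p + v p * pd₁ u p + u p * pd₁ v p = 0) ∧
      (pd₂ v p - pd₁ u p + v p * pd₁ v p = 0) := by
    intro p hp
    have hq := hmem p hp
    have d1 : DifferentiableAt ℝ (pd₁ f) (u p, v p) :=
      (contDiffAt_pd₁ (m := 1) (by norm_num) (hf2 _ hq)).differentiableAt one_ne_zero
    have d2 : DifferentiableAt ℝ (pd₂ f) (u p, v p) :=
      (contDiffAt_pd₂ (m := 1) (by norm_num) (hf2 _ hq)).differentiableAt one_ne_zero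
    have du : DifferentiableAt ℝ u p :=
      (hu.contDiffAt (hW.mem_nhds hp)).differentiableAt one_ne_zero
    have dv : DifferentiableAt ℝ v p :=
      (hv.contDiffAt (hW.mem_nhds hp)).differentiableAt one_ne_zero
    have d1' : DifferentiableAt ℝ (fun p => pd₁ f (u p, v p)) p :=
      DifferentiableAt.comp (f := fun p => (u p, v p)) p d1 (du.prodMk dv)
    have d2' : DifferentiableAt ℝ (fun p => pd₂ f (u p, v p)) p :=
      DifferentiableAt.comp (f := fun p => (u p, v p)) p d2 (du.prodMk dv)
    have h1 : (Prod.fst : ℝ × ℝ → ℝ) =ᶠ[𝓝 p] v * Prod.snd + fun p => pd₁ f (u p, v p) := by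
      filter_upwards [hW.mem_nhds hp] with p' hp' using (hod p' hp').1
    have h2 : (fun _ : ℝ × ℝ => (0 : ℝ)) =ᶠ[𝓝 p] u * Prod.snd + fun p => pd₂ f (u p, v p) := by
      filter_upwards [hW.mem_nhds hp] with p' hp' using (hod p' hp').2
    have ds : DifferentiableAt ℝ (Prod.snd : ℝ × ℝ → ℝ) p := differentiableAt_snd
    have e1 := pd₁_congr h1
    have e2 := pd₁_congr h2
    have e3 := pd₂_congr h1
    have e4 := pd₂_congr h2
    rw [pd₁_add (dv.mul ds) d1', pd₁_mul dv ds, pd₁_comp d1 du dv, pd₁_fst, pd₁_snd] at e1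
    rw [pd₁_add (du.mul ds) d2', pd₁_mul du ds, pd₁_comp d2 du dv, pd₁_snd,
      pd₁_pd₂_comm (hf2 _ hq)] at e2
    rw [pd₂_add (dv.mul ds) d1', pd₂_mul dv ds, pd₂_comp d1 du dv, pd₂_fst, pd₂_snd] at e3
    rw [pd₂_add (du.mul ds) d2', pd₂_mul du ds, pd₂_comp d2 du dv, pd₂_snd,
      pd₁_pd₂_comm (hf2 _ hq)] at e4
    rw [show pd₁ (fun _ : ℝ × ℝ => (0 : ℝ)) p = 0 by simp [pd₁]] at e2
    rw [show pd₂ (fun _ : ℝ × ℝ => (0 : ℝ)) p = 0 by simp [pd₂]] at e4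
    have hl := hlin _ hq
    have hD := hdet p hp
    dsimp only at hl
    have hvv : pd₂ (pd₂ f) (u p, v p) = -(u p * pd₁ (pd₁ f) (u p, v p)) := by linarith
    rw [hvv] at e2 e4
    generalize pd₁ (pd₁ f) (u p, v p) = A at *
    generalize pd₂ (pd₁ f) (u p, v p) = B at *
    have f1 : A * (pd₂ u p + v p * pd₁ u p + u p * pd₁ v p) +
        (p.2 + B) * (pd₂ v p - pd₁ u p + v p * pd₁ v p) = 0 := by
      linear_combination e2 - v p * e1 - e3
    have f2 : (p.2 + B) * (pd₂ u p + v p * pd₁ u p + u p * pd₁ v p) -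
        u p * A * (pd₂ v p - pd₁ u p + v p * pd₁ v p) = 0 := by
      linear_combination -v p * e2 - u p * e1 - e4
    constructor
    · refine (mul_eq_zero.1 ?_).resolve_left hD
      linear_combination u p * A * f1 + (p.2 + B) * f2
    · refine (mul_eq_zero.1 ?_).resolve_left hD
      linear_combination (p.2 + B) * f1 - A * f2
  exact ⟨hu, hv, fun p hp => (key p hp).1, fun p hp => (key p hp).2⟩

/-- The map `((u, v), t) ↦ ((v t + f_u, u t + f_v), t)`; the hodograph equations at `(x, t)` say
that it takes `((u, v), t)` to `((x, 0), t)`. -/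
noncomputable def hodographMap (f : ℝ × ℝ → ℝ) (w : (ℝ × ℝ) × ℝ) : (ℝ × ℝ) × ℝ :=
  ((w.1.2 * w.2 + pd₁ f w.1, w.1.1 * w.2 + pd₂ f w.1), w.2)

theorem hodographEq_iff {f : ℝ × ℝ → ℝ} {p q : ℝ × ℝ} :
    HodographEq f p q ↔ hodographMap f (q, p.2) = ((p.1, 0), p.2) := by
  simp only [HodographEq, hodographMap, Prod.mk.injEq, and_true]
  exact and_congr eq_comm eq_comm

theorem contDiffAt_hodographMap {m n : WithTop ℕ∞} (hmn : m + 1 ≤ n) {f : ℝ × ℝ → ℝ}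
    {w : (ℝ × ℝ) × ℝ} (hf : ∀ᶠ q in 𝓝 w.1, ContDiffAt ℝ n f q) :
    ContDiffAt ℝ m (hodographMap f) w := by
  have h1 : ContDiffAt ℝ m (fun w : (ℝ × ℝ) × ℝ => pd₁ f w.1) w :=
    (contDiffAt_pd₁ hmn hf).comp w contDiffAt_fst
  have h2 : ContDiffAt ℝ m (fun w : (ℝ × ℝ) × ℝ => pd₂ f w.1) w :=
    (contDiffAt_pd₂ hmn hf).comp w contDiffAt_fst
  exact ((((contDiffAt_snd.comp w contDiffAt_fst).mul contDiffAt_snd).add h1).prodMk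
    (((contDiffAt_fst.comp w contDiffAt_fst).mul contDiffAt_snd).add h2)).prodMk contDiffAt_snd

theorem injective_fderiv_hodographMap {f : ℝ × ℝ → ℝ} {w : (ℝ × ℝ) × ℝ}
    (hf : ∀ᶠ q in 𝓝 w.1, ContDiffAt ℝ 2 f q)
    (hlin : pd₂ (pd₂ f) w.1 + w.1.1 * pd₁ (pd₁ f) w.1 = 0)
    (hdet : w.1.1 * pd₁ (pd₁ f) w.1 ^ 2 + (w.2 + pd₂ (pd₁ f) w.1) ^ 2 ≠ 0) :
    Function.Injective (fderiv ℝ (hodographMap f) w) := by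
  have d1 : DifferentiableAt ℝ (pd₁ f) w.1 :=
    (contDiffAt_pd₁ (m := 1) (by norm_num) hf).differentiableAt one_ne_zero
  have d2 : DifferentiableAt ℝ (pd₂ f) w.1 :=
    (contDiffAt_pd₂ (m := 1) (by norm_num) hf).differentiableAt one_ne_zero
  have hfst := hasFDerivAt_fst (𝕜 := ℝ) (E := ℝ × ℝ) (F := ℝ) (p := w)
  have hsnd := hasFDerivAt_snd (𝕜 := ℝ) (E := ℝ × ℝ) (F := ℝ) (p := w)
  have h1 := ((hfst.snd.mul hsnd).add ((hasFDerivAt_pd d1).comp w hfst))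
  have h2 := ((hfst.fst.mul hsnd).add ((hasFDerivAt_pd d2).comp w hfst))
  have h3 : HasFDerivAt (hodographMap f) _ w := (h1.prodMk h2).prodMk hsnd
  rw [h3.fderiv, injective_iff_map_eq_zero]
  rintro ⟨⟨a, b⟩, s⟩ h
  simp [pd₁_pd₂_comm hf] at h
  obtain ⟨⟨e1, e2⟩, rfl⟩ := h
  rw [show pd₂ (pd₂ f) w.1 = -(w.1.1 * pd₁ (pd₁ f) w.1) by linarith] at e2
  have ha : a = 0 := by
    refine (mul_eq_zero.1 ?_).resolve_left hdet
    linear_combination w.1.1 * pd₁ (pd₁ f) w.1 * e1 + (w.2 + pd₂ (pd₁ f) w.1) * e2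
  have hb : b = 0 := by
    refine (mul_eq_zero.1 ?_).resolve_left hdet
    linear_combination (w.2 + pd₂ (pd₁ f) w.1) * e1 - pd₁ (pd₁ f) w.1 * e2
  simp [ha, hb]

/-- Every neighbourhood of the segment `[a, b] × {0}` contains a rectangle `box a b δ`. -/
theorem exists_box_subset {a b : ℝ} (hab : a ≤ b) {S : Set (ℝ × ℝ)}
    (hS : S ∈ 𝓝ˢ (Icc a b ×ˢ {(0 : ℝ)})) : ∃ δ > 0, box a b δ ⊆ S := by
  have hK : IsCompact (Icc a b ×ˢ {(0 : ℝ)}) := isCompact_Icc.prod isCompact_singleton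
  obtain ⟨δ, hδ, hsub⟩ := hK.exists_thickening_subset_open isOpen_interior
    (subset_interior_iff_mem_nhdsSet.2 hS)
  refine ⟨δ, hδ, fun p hp => interior_subset (hsub ?_)⟩
  obtain ⟨⟨h1, h2⟩, h3, h4⟩ := hp
  rw [Metric.mem_thickening_iff]
  refine ⟨(max a (min b p.1), 0), ⟨⟨le_max_left _ _, max_le hab (min_le_left _ _)⟩, rfl⟩, ?_⟩
  rw [Prod.dist_eq, max_lt_iff, Real.dist_eq, Real.dist_eq, sub_zero]
  refine ⟨?_, abs_lt.2 ⟨h3, h4⟩⟩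
  rw [abs_lt]
  rcases le_total b p.1 with h | h
  · rw [min_eq_left h, max_eq_right hab]
    constructor <;> linarith
  · rw [min_eq_right h]
    rcases le_total a p.1 with h' | h'
    · rw [max_eq_right h']
      constructor <;> linarith
    · rw [max_eq_left h']
      constructor <;> linarith

theorem isOpen_box (a b δ : ℝ) : IsOpen (box a b δ) := isOpen_Ioo.prod isOpen_Ioo

/-- A nondegenerate solution of the hodograph equations at `t = 0` extends to a solution of the
system: the inverse function theorem applies to `((u, v), t) ↦ ((v t + f_u, u t + f_v), t)`. -/
theorem exists_solution_of_hodograph {Ω : Set (ℝ × ℝ)} {f : ℝ × ℝ → ℝ} {u₀ v₀ : ℝ}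
    (hΩ : IsOpen Ω) (hf : ContDiffOn ℝ 2 f Ω) (hlin : SolvesLinearPDE f Ω)
    (h₀ : (u₀, v₀) ∈ Ω) (hu₀ : 0 ≤ u₀) (hfv : pd₂ f (u₀, v₀) = 0)
    (hne : u₀ ^ 2 * pd₁ (pd₁ f) (u₀, v₀) ^ 2 + pd₂ (pd₁ f) (u₀, v₀) ^ 2 ≠ 0) :
    ∃ (N : Set (ℝ × ℝ)) (δ : ℝ) (u v : ℝ × ℝ → ℝ),
      IsOpen N ∧ N ⊆ Ω ∧ (u₀, v₀) ∈ N ∧ 0 < δ ∧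
      DeterminedByHodograph f N u v (box (pd₁ f (u₀, v₀)) (pd₁ f (u₀, v₀)) δ) ∧
      u (pd₁ f (u₀, v₀), 0) = u₀ ∧ v (pd₁ f (u₀, v₀), 0) = v₀ ∧
      IsSolution u v (box (pd₁ f (u₀, v₀)) (pd₁ f (u₀, v₀)) δ) ∧
      (AnalyticOnNhd ℝ f Ω →
        AnalyticOnNhd ℝ u (box (pd₁ f (u₀, v₀)) (pd₁ f (u₀, v₀)) δ) ∧
        AnalyticOnNhd ℝ v (box (pd₁ f (u₀, v₀)) (pd₁ f (u₀, v₀)) δ)) := by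
  have hf2 : ∀ q ∈ Ω, ∀ᶠ q' in 𝓝 q, ContDiffAt ℝ 2 f q' := fun q hq => by
    filter_upwards [hΩ.mem_nhds hq] with q' hq' using hf.contDiffAt (hΩ.mem_nhds hq')
  have hf1 : ∀ q ∈ Ω, ContDiffAt ℝ 1 (pd₁ f) q := fun q hq =>
    contDiffAt_pd₁ (by norm_num) (hf2 q hq)
  have hf1' : ∀ᶠ q in 𝓝 (u₀, v₀), ContDiffAt ℝ 1 (pd₁ f) q := by
    filter_upwards [hΩ.mem_nhds h₀] with q hq using hf1 q hq
  have cA : ContinuousAt (pd₁ (pd₁ f)) (u₀, v₀) :=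
    (contDiffAt_pd₁ (m := 0) (by norm_num) hf1').continuousAt
  have cB : ContinuousAt (pd₂ (pd₁ f)) (u₀, v₀) :=
    (contDiffAt_pd₂ (m := 0) (by norm_num) hf1').continuousAt
  let D : (ℝ × ℝ) × ℝ → ℝ := fun w =>
    w.1.1 * pd₁ (pd₁ f) w.1 ^ 2 + (w.2 + pd₂ (pd₁ f) w.1) ^ 2
  have hD₀ : D ((u₀, v₀), 0) ≠ 0 := by
    simp only [D, zero_add]
    intro h
    have h1 : 0 ≤ u₀ * pd₁ (pd₁ f) (u₀, v₀) ^ 2 := by positivity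
    have h2 := sq_nonneg (pd₂ (pd₁ f) (u₀, v₀))
    apply hne
    have h3 : u₀ * pd₁ (pd₁ f) (u₀, v₀) ^ 2 = 0 := by linarith
    have h4 : pd₂ (pd₁ f) (u₀, v₀) ^ 2 = 0 := by linarith
    linear_combination u₀ * h3 + h4
  have cD : ContinuousAt D ((u₀, v₀), 0) := by
    have c1 : ContinuousAt (fun w : (ℝ × ℝ) × ℝ => pd₁ (pd₁ f) w.1) ((u₀, v₀), 0) :=
      ContinuousAt.comp (f := Prod.fst) (x := ((u₀, v₀), (0 : ℝ))) cA continuousAt_fst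
    have c2 : ContinuousAt (fun w : (ℝ × ℝ) × ℝ => pd₂ (pd₁ f) w.1) ((u₀, v₀), 0) :=
      ContinuousAt.comp (f := Prod.fst) (x := ((u₀, v₀), (0 : ℝ))) cB continuousAt_fst
    fun_prop
  obtain ⟨s, hs, hinj⟩ := exists_injOn_nhds (f := hodographMap f) (x := ((u₀, v₀), 0))
    (contDiffAt_hodographMap (by norm_num) (hf2 _ h₀))
    (injective_fderiv_hodographMap (hf2 _ h₀) (hlin _ h₀) hD₀)
  have hΩ' : {w : (ℝ × ℝ) × ℝ | w.1 ∈ Ω} ∈ 𝓝 ((u₀, v₀), (0 : ℝ)) :=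
    continuousAt_fst.preimage_mem_nhds (hΩ.mem_nhds h₀)
  obtain ⟨N, T, hN, h₀N, hT, h₀T, hNT⟩ := mem_nhds_prod_iff'.1
    (inter_mem (inter_mem hs hΩ') (cD.eventually_ne hD₀))
  -- On `N ×ˢ T` the map is injective and its derivative invertible.
  have hUo : IsOpen (N ×ˢ T) := hN.prod hT
  have hUΩ : ∀ w ∈ N ×ˢ T, w.1 ∈ Ω := fun w hw => (hNT hw).1.2
  have hUD : ∀ w ∈ N ×ˢ T, D w ≠ 0 := fun w hw => (hNT hw).2
  have hUinj : InjOn (hodographMap f) (N ×ˢ T) := hinj.mono fun w hw => (hNT hw).1.1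
  obtain ⟨himg, g, hg, hgs⟩ := exists_inverse_of_injOn hUo hUinj
    (fun w hw => contDiffAt_hodographMap (by norm_num) (hf2 _ (hUΩ w hw)))
    (fun w hw => injective_fderiv_hodographMap (hf2 _ (hUΩ w hw)) (hlin _ (hUΩ w hw)) (hUD w hw))
  let ι : ℝ × ℝ → (ℝ × ℝ) × ℝ := fun p => ((p.1, 0), p.2)
  have hw₀ : hodographMap f ((u₀, v₀), 0) = ι (pd₁ f (u₀, v₀), 0) := by
    simp [hodographMap, ι, hfv]
  have hι : ContDiff ℝ ω ι := (contDiff_fst.prodMk contDiff_const).prodMk contDiff_snd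
  obtain ⟨δ, hδ, hbox⟩ := exists_box_subset (le_refl (pd₁ f (u₀, v₀)))
    (S := ι ⁻¹' (hodographMap f '' (N ×ˢ T))) (by
      rw [Icc_self, singleton_prod_singleton, nhdsSet_singleton]
      refine hι.continuous.continuousAt.preimage_mem_nhds (himg.mem_nhds ?_)
      rw [← hw₀]
      exact mem_image_of_mem _ ⟨h₀N, h₀T⟩)
  -- On the rectangle, `g (ι p)` is the solution of the hodograph equations, paired with `t`.
  have hsol : ∀ p ∈ box (pd₁ f (u₀, v₀)) (pd₁ f (u₀, v₀)) δ,
      ((g (ι p)).1, p.2) ∈ N ×ˢ T ∧ hodographMap f ((g (ι p)).1, p.2) = ι p := by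
    intro p hp
    obtain ⟨w, hw, hwp⟩ := hbox hp
    have hw2 : w.2 = p.2 := congrArg Prod.snd hwp
    rw [← hwp, hg w hw, ← hw2]
    exact ⟨hw, rfl⟩
  have hqΩ : ∀ p ∈ box (pd₁ f (u₀, v₀)) (pd₁ f (u₀, v₀)) δ, (g (ι p)).1 ∈ Ω := fun p hp =>
    (hNT (hsol p hp).1).1.2
  have hsm : ∀ n : WithTop ℕ∞, ∀ p ∈ box (pd₁ f (u₀, v₀)) (pd₁ f (u₀, v₀)) δ,
      ContDiffAt ℝ n (hodographMap f) ((g (ι p)).1, p.2) →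
      ContDiffAt ℝ n (fun p => (g (ι p)).1) p := by
    intro n p hp hn
    obtain ⟨h1, h2⟩ := hsol p hp
    have h3 := hgs _ h1 n hn
    rw [h2] at h3
    exact contDiffAt_fst.comp p (h3.comp p (hι.contDiffAt.of_le le_top))
  refine ⟨N, δ, fun p => (g (ι p)).1.1, fun p => (g (ι p)).1.2, hN,
    fun q hq => hUΩ (q, 0) ⟨hq, h₀T⟩, h₀N, hδ, ?_, ?_, ?_, ?_, ?_⟩
  · intro p hp
    obtain ⟨h1, h2⟩ := hsol p hp
    refine ⟨h1.1, fun q hq => ?_⟩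
    rw [hodographEq_iff]
    constructor
    · intro h
      exact congrArg Prod.fst (hUinj (show (q, p.2) ∈ N ×ˢ T from ⟨hq, h1.2⟩) h1 (h.trans h2.symm))
    · intro h
      rw [h]
      exact h2
  · simp only [← hw₀, hg _ (show ((u₀, v₀), (0 : ℝ)) ∈ N ×ˢ T from ⟨h₀N, h₀T⟩)]
  · simp only [← hw₀, hg _ (show ((u₀, v₀), (0 : ℝ)) ∈ N ×ˢ T from ⟨h₀N, h₀T⟩)]
  · have hc : ∀ p ∈ box (pd₁ f (u₀, v₀)) (pd₁ f (u₀, v₀)) δ,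
        ContDiffAt ℝ 1 (fun p => (g (ι p)).1) p := fun p hp => hsm 1 p hp
      (contDiffAt_hodographMap (by norm_num)
        (hf2 _ (hqΩ p hp)))
    refine isSolution_of_hodographEq hΩ hf hlin (isOpen_box _ _ _)
      (fun p hp => (contDiffAt_fst.comp p (hc p hp)).contDiffWithinAt)
      (fun p hp => (contDiffAt_snd.comp p (hc p hp)).contDiffWithinAt)
      hqΩ (fun p hp => hodographEq_iff.2 (hsol p hp).2)
      (fun p hp => hUD _ (hsol p hp).1)
  · intro hfa
    have hc : ∀ p ∈ box (pd₁ f (u₀, v₀)) (pd₁ f (u₀, v₀)) δ,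
        ContDiffAt ℝ ω (fun p => (g (ι p)).1) p := fun p hp => hsm ω p hp
      (contDiffAt_hodographMap (n := ω) le_rfl
        (eventually_contDiffAt (hfa _ (hqΩ p hp))))
    exact ⟨fun p hp => (contDiffAt_fst.comp p (hc p hp)).analyticAt,
      fun p hp => (contDiffAt_snd.comp p (hc p hp)).analyticAt⟩

/-! ### From the solution to the hodograph equations -/

theorem IsSolution.mono {u v : ℝ × ℝ → ℝ} {W W' : Set (ℝ × ℝ)} (h : IsSolution u v W)
    (hW : W' ⊆ W) : IsSolution u v W' :=
  ⟨h.contDiffOn_u.mono hW, h.contDiffOn_v.mono hW, fun p hp => h.eq_u p (hW hp),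
    fun p hp => h.eq_v p (hW hp)⟩

/-- A closed analytic one-form `P dx + Q dt` on an open convex set has an analytic primitive. -/
theorem exists_analytic_potential {P Q : ℝ × ℝ → ℝ} {W : Set (ℝ × ℝ)} (hW : IsOpen W)
    (hconv : Convex ℝ W) (hP : AnalyticOnNhd ℝ P W) (hQ : AnalyticOnNhd ℝ Q W)
    (hPQ : ∀ p ∈ W, pd₂ P p = pd₁ Q p) :
    ∃ F : ℝ × ℝ → ℝ, AnalyticOnNhd ℝ F W ∧ ∀ p ∈ W, pd₁ F p = P p ∧ pd₂ F p = Q p := by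
  let η : ℝ × ℝ → ℝ × ℝ →L[ℝ] ℝ := fun p =>
    P p • ContinuousLinearMap.fst ℝ ℝ ℝ + Q p • ContinuousLinearMap.snd ℝ ℝ ℝ
  have hη : ∀ p ∈ W, HasFDerivAt η _ p := fun p hp =>
    ((hasFDerivAt_pd (hP p hp).differentiableAt).smul_const (ContinuousLinearMap.fst ℝ ℝ ℝ)).add
      ((hasFDerivAt_pd (hQ p hp).differentiableAt).smul_const (ContinuousLinearMap.snd ℝ ℝ ℝ))
  have hηa : ∀ p ∈ W, AnalyticAt ℝ η p := fun p hp =>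
    ((hP p hp).smul analyticAt_const).add ((hQ p hp).smul analyticAt_const)
  obtain ⟨F, hF⟩ := hconv.exists_forall_hasFDerivAt_of_fderiv_symmetric hW
    (fun p hp => (hη p hp).differentiableAt.differentiableWithinAt) (fun p hp x y => by
      rw [(hη p hp).fderiv]
      simp [hPQ p hp]
      ring)
  refine ⟨F, fun p hp => analyticAt_of_hasFDerivAt ?_ (hηa p hp), fun p hp => ⟨?_, ?_⟩⟩
  · filter_upwards [hW.mem_nhds hp] with q hq using hF q hq
  · rw [pd₁_eq_of_hasFDerivAt (hF p hp)]
    simp [η]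
  · rw [pd₂_eq_of_hasFDerivAt (hF p hp)]
    simp [η]

theorem injective_fderiv_prodMk {u v : ℝ × ℝ → ℝ} {p : ℝ × ℝ} (hu : DifferentiableAt ℝ u p)
    (hv : DifferentiableAt ℝ v p) (hJ : pd₁ u p * pd₂ v p - pd₂ u p * pd₁ v p ≠ 0) :
    Function.Injective (fderiv ℝ (fun p => (u p, v p)) p) := by
  rw [((hasFDerivAt_pd hu).prodMk (hasFDerivAt_pd hv)).fderiv, injective_iff_map_eq_zero]
  rintro ⟨a, b⟩ h
  simp at h
  obtain ⟨e1, e2⟩ := h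
  have ha : a = 0 := by
    refine (mul_eq_zero.1 ?_).resolve_left hJ
    linear_combination pd₂ v p * e1 - pd₂ u p * e2
  have hb : b = 0 := by
    refine (mul_eq_zero.1 ?_).resolve_left hJ
    linear_combination pd₁ u p * e2 - pd₁ v p * e1
  simp [ha, hb]

/-- The Jacobian determinant of `(x, t) ↦ (u, v)` for a solution of the system. -/
theorem IsSolution.jacobian_eq {u v : ℝ × ℝ → ℝ} {W : Set (ℝ × ℝ)} (h : IsSolution u v W)
    {p : ℝ × ℝ} (hp : p ∈ W) :
    pd₁ u p * pd₂ v p - pd₂ u p * pd₁ v p = pd₁ u p ^ 2 + u p * pd₁ v p ^ 2 := by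
  linear_combination pd₁ u p * h.eq_v p hp - pd₁ v p * h.eq_u p hp

/-- The hodograph transformation. For an analytic solution with positive `u` and nonvanishing
Jacobian, the form `x du - t d(uv)` is closed by the first equation of the system; its potential,
written as a function `f` of `(u, v)`, satisfies `f_u = x - v t` and `f_v = -u t`, and `f` satisfies
the linear equation by the second equation of the system. -/
theorem exists_hodograph_potential {u v : ℝ × ℝ → ℝ} {W : Set (ℝ × ℝ)} (hW : IsOpen W)
    (hconv : Convex ℝ W) (hu : AnalyticOnNhd ℝ u W) (hv : AnalyticOnNhd ℝ v W)
    (hs : IsSolution u v W) (hpos : ∀ p ∈ W, 0 < u p)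
    (hJ : ∀ p ∈ W, pd₁ u p ^ 2 + u p * pd₁ v p ^ 2 ≠ 0)
    (hinj : InjOn (fun p => (u p, v p)) W) :
    ∃ (Ω : Set (ℝ × ℝ)) (f : ℝ × ℝ → ℝ), IsOpen Ω ∧ (∀ q ∈ Ω, 0 < q.1) ∧ AnalyticOnNhd ℝ f Ω ∧
      SolvesLinearPDE f Ω ∧ DeterminedByHodograph f Ω u v W := by
  have hJ' : ∀ p ∈ W, pd₁ u p * pd₂ v p - pd₂ u p * pd₁ v p ≠ 0 := fun p hp => by
    rw [hs.jacobian_eq hp]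
    exact hJ p hp
  have hua := fun p hp => (hu p hp).differentiableAt
  have hva := fun p hp => (hv p hp).differentiableAt
  obtain ⟨hΩ, g, hg, hgs⟩ := exists_inverse_of_injOn hW hinj
    (fun p hp => (hu p hp).contDiffAt.prodMk (hv p hp).contDiffAt)
    (fun p hp => injective_fderiv_prodMk (hua p hp) (hva p hp) (hJ' p hp))
  set Ψ : ℝ × ℝ → ℝ × ℝ := fun p => (u p, v p) with hΨ
  have hga : ∀ p ∈ W, AnalyticAt ℝ g (Ψ p) := fun p hp =>
    (hgs p hp ω ((hu p hp).contDiffAt.prodMk (hv p hp).contDiffAt)).analyticAt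
  have hux : AnalyticOnNhd ℝ (pd₁ u) W := fun p hp => analyticAt_pd₁ (hu p hp)
  have hut : AnalyticOnNhd ℝ (pd₂ u) W := fun p hp => analyticAt_pd₂ (hu p hp)
  have hwx : AnalyticOnNhd ℝ (pd₁ (u * v)) W := fun p hp => analyticAt_pd₁ (hu.mul hv p hp)
  have hwt : AnalyticOnNhd ℝ (pd₂ (u * v)) W := fun p hp => analyticAt_pd₂ (hu.mul hv p hp)
  have hfst : AnalyticOnNhd ℝ (Prod.fst : ℝ × ℝ → ℝ) W := fun p _ => analyticAt_fst
  have hsnd : AnalyticOnNhd ℝ (Prod.snd : ℝ × ℝ → ℝ) W := fun p _ => analyticAt_snd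
  obtain ⟨F, hFa, hF⟩ := exists_analytic_potential hW hconv
    (P := Prod.fst * pd₁ u - Prod.snd * pd₁ (u * v))
    (Q := Prod.fst * pd₂ u - Prod.snd * pd₂ (u * v))
    ((hfst.mul hux).sub (hsnd.mul hwx)) ((hfst.mul hut).sub (hsnd.mul hwt)) (fun p hp => by
      have dx := (hfst p hp).differentiableAt
      have dt := (hsnd p hp).differentiableAt
      have d1 := (hux p hp).differentiableAt
      have d2 := (hut p hp).differentiableAt
      have d3 := (hwx p hp).differentiableAt
      have d4 := (hwt p hp).differentiableAt
      rw [pd₂_sub (dx.mul d1) (dt.mul d3), pd₂_mul dx d1, pd₂_mul dt d3, pd₂_fst, pd₂_snd,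
        pd₁_sub (dx.mul d2) (dt.mul d4), pd₁_mul dx d2, pd₁_mul dt d4, pd₁_fst, pd₁_snd,
        pd₁_pd₂_comm (eventually_contDiffAt (hu p hp)),
        pd₁_pd₂_comm (g := u * v) (eventually_contDiffAt (hu.mul hv p hp)),
        pd₁_mul (hua p hp) (hva p hp)]
      linear_combination -hs.eq_u p hp)
  let f : ℝ × ℝ → ℝ := fun q => F (g q)
  have hfa : ∀ p ∈ W, AnalyticAt ℝ f (Ψ p) := fun p hp =>
    AnalyticAt.fun_comp (by rw [hg p hp]; exact hFa p hp) (hga p hp)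
  -- The gradient of `f` follows from `F = f ∘ Ψ`, as the Jacobian matrix of `Ψ` is invertible.
  have hgrad : ∀ p ∈ W, pd₁ f (Ψ p) = p.1 - p.2 * v p ∧ pd₂ f (Ψ p) = -(p.2 * u p) := by
    intro p hp
    have hfF : F =ᶠ[𝓝 p] fun p => f (u p, v p) := by
      filter_upwards [hW.mem_nhds hp] with q hq
      simp only [f]
      rw [hg q hq]
    have e1 := (pd₁_congr hfF).symm.trans (hF p hp).1
    have e2 := (pd₂_congr hfF).symm.trans (hF p hp).2
    have df : DifferentiableAt ℝ f (u p, v p) := (hfa p hp).differentiableAt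
    rw [pd₁_comp df (hua p hp) (hva p hp)] at e1
    rw [pd₂_comp df (hua p hp) (hva p hp)] at e2
    simp only [Pi.sub_apply, Pi.mul_apply, pd₁_mul (hua p hp) (hva p hp),
      pd₂_mul (hua p hp) (hva p hp)] at e1 e2
    constructor
    · refine sub_eq_zero.1 ((mul_eq_zero.1 ?_).resolve_left (hJ' p hp))
      linear_combination pd₂ v p * e1 - pd₁ v p * e2
    · refine sub_eq_zero.1 ((mul_eq_zero.1 ?_).resolve_left (hJ' p hp))
      linear_combination pd₁ u p * e2 - pd₂ u p * e1
  refine ⟨Ψ '' W, f, hΩ, ?_, ?_, ?_, ?_⟩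
  · rintro _ ⟨p, hp, rfl⟩
    exact hpos p hp
  · rintro _ ⟨p, hp, rfl⟩
    exact hfa p hp
  · rintro _ ⟨p, hp, rfl⟩
    let X : ℝ × ℝ → ℝ := fun q => (g q).1
    let T : ℝ × ℝ → ℝ := fun q => (g q).2
    have dX : DifferentiableAt ℝ X (Ψ p) := (hga p hp).differentiableAt.fst
    have dT : DifferentiableAt ℝ T (Ψ p) := (hga p hp).differentiableAt.snd
    have d1 : DifferentiableAt ℝ (Prod.fst : ℝ × ℝ → ℝ) (Ψ p) := differentiableAt_fst
    have d2 : DifferentiableAt ℝ (Prod.snd : ℝ × ℝ → ℝ) (Ψ p) := differentiableAt_snd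
    have h1 : pd₁ f =ᶠ[𝓝 (Ψ p)] X - T * Prod.snd := by
      filter_upwards [hΩ.mem_nhds (mem_image_of_mem _ hp)]
      rintro _ ⟨p', hp', rfl⟩
      rw [(hgrad p' hp').1]
      simp [X, T, hg p' hp', hΨ]
    have h2 : pd₂ f =ᶠ[𝓝 (Ψ p)] (0 : ℝ × ℝ → ℝ) - T * Prod.fst := by
      filter_upwards [hΩ.mem_nhds (mem_image_of_mem _ hp)]
      rintro _ ⟨p', hp', rfl⟩
      rw [(hgrad p' hp').2]
      simp [T, hg p' hp', hΨ]
    have hX : (Prod.fst : ℝ × ℝ → ℝ) =ᶠ[𝓝 p] fun p => X (u p, v p) := by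
      filter_upwards [hW.mem_nhds hp] with q hq
      exact (congrArg Prod.fst (hg q hq)).symm
    have hT : (Prod.snd : ℝ × ℝ → ℝ) =ᶠ[𝓝 p] fun p => T (u p, v p) := by
      filter_upwards [hW.mem_nhds hp] with q hq
      exact (congrArg Prod.snd (hg q hq)).symm
    have x1 := pd₁_congr hX
    have x2 := pd₂_congr hX
    have t1 := pd₁_congr hT
    have t2 := pd₂_congr hT
    rw [pd₁_comp dX (hua p hp) (hva p hp), pd₁_fst] at x1
    rw [pd₂_comp dX (hua p hp) (hva p hp), pd₂_fst] at x2
    rw [pd₁_comp dT (hua p hp) (hva p hp), pd₁_snd] at t1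
    rw [pd₂_comp dT (hua p hp) (hva p hp), pd₂_snd] at t2
    have d0 : DifferentiableAt ℝ (0 : ℝ × ℝ → ℝ) (Ψ p) := differentiableAt_const 0
    have z0 : pd₂ (0 : ℝ × ℝ → ℝ) (Ψ p) = 0 := by simp [pd₂]
    rw [pd₁_congr h1, pd₂_congr h2, pd₁_sub dX (dT.mul d2), pd₁_mul dT d2, pd₁_snd,
      pd₂_sub d0 (dT.mul d1), pd₂_mul dT d1, pd₂_fst, z0]
    have heq := hs.eq_v p hp
    simp only [hΨ] at *
    refine (mul_eq_zero.1 ?_).resolve_left (hJ' p hp)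
    generalize pd₁ X (u p, v p) = Xu at *
    generalize pd₂ X (u p, v p) = Xv at *
    generalize pd₁ T (u p, v p) = Tu at *
    generalize pd₂ T (u p, v p) = Tv at *
    linear_combination u p * heq - u p * (pd₂ v p * x1 - pd₁ v p * x2) +
      u p * v p * (pd₂ v p * t1 - pd₁ v p * t2) + u p * (pd₁ u p * t2 - pd₂ u p * t1)
  · intro p hp
    refine ⟨mem_image_of_mem _ hp, ?_⟩
    rintro _ ⟨p', hp', rfl⟩
    have hu0 := hpos p' hp'
    rw [HodographEq, (hgrad p' hp').1, (hgrad p' hp').2]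
    constructor
    · rintro ⟨e1, e2⟩
      simp only [hΨ] at e1 e2
      have ht : p.2 = p'.2 := by
        refine sub_eq_zero.1 ((mul_eq_zero.1 ?_).resolve_left hu0.ne')
        linear_combination -e2
      have hx : p.1 = p'.1 := by rw [e1, ht]; ring
      rw [Prod.ext hx ht]
    · intro h
      have : p' = p := hinj hp' hp h
      subst this
      simp only [hΨ]
      constructor <;> ring

/-! ### The Cauchy problem along an interval -/

/-- The solution of the Cauchy problem together with its hodograph potential. The local solutions
are germs of one pair of functions, so that compactness of `[a, b]` gives a common rectangle, on
which moreover `(x, t) ↦ (u, v)` is injective since it is so on `[a, b] × {0}`. -/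
theorem exists_cauchy_solution {a b : ℝ} {uI vI : ℝ → ℝ} (hab : a ≤ b)
    (hu : AnalyticOnNhd ℝ uI (Icc a b)) (hv : AnalyticOnNhd ℝ vI (Icc a b))
    (hpos : ∀ x ∈ Icc a b, 0 < uI x)
    (hreg : ∀ x ∈ Icc a b, deriv uI x ^ 2 + deriv vI x ^ 2 ≠ 0)
    (hinj : InjOn (fun x => (uI x, vI x)) (Icc a b)) :
    ∃ (Ω : Set (ℝ × ℝ)) (f : ℝ × ℝ → ℝ) (δ : ℝ) (u v : ℝ × ℝ → ℝ),
      IsOpen Ω ∧ (∀ q ∈ Ω, 0 < q.1) ∧ AnalyticOnNhd ℝ f Ω ∧ SolvesLinearPDE f Ω ∧ 0 < δ ∧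
      AnalyticOnNhd ℝ u (box a b δ) ∧ AnalyticOnNhd ℝ v (box a b δ) ∧
      IsSolution u v (box a b δ) ∧ (∀ x, u (x, 0) = uI x ∧ v (x, 0) = vI x) ∧
      DeterminedByHodograph f Ω u v (box a b δ) := by
  set u := cauchyU uI vI with hudef
  set v := cauchyV uI vI with hvdef
  set K : Set (ℝ × ℝ) := Icc a b ×ˢ {(0 : ℝ)} with hK
  have hKc : IsCompact K := isCompact_Icc.prod isCompact_singleton
  -- The points at which all conditions required on the rectangle hold.
  let G : Set (ℝ × ℝ) := {p | AnalyticAt ℝ u p ∧ AnalyticAt ℝ v p ∧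
    ((pd₂ u p + v p * pd₁ u p + u p * pd₁ v p = 0) ∧ (pd₂ v p - pd₁ u p + v p * pd₁ v p = 0)) ∧
    0 < u p ∧ pd₁ u p ^ 2 + u p * pd₁ v p ^ 2 ≠ 0}
  have hG : ∀ p ∈ K, G ∈ 𝓝 p := by
    rintro ⟨x, t⟩ ⟨hx, rfl : t = 0⟩
    obtain ⟨h1, h2, h3⟩ := cauchy_local (hu x hx) (hv x hx)
    have hpos' : 0 < u (x, 0) := by
      rw [hudef, cauchyU_zero]
      exact hpos x hx
    have hux : pd₁ u (x, 0) = deriv uI x := by simp [pd₁, hudef, cauchyU_zero]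
    have hvx : pd₁ v (x, 0) = deriv vI x := by simp [pd₁, hvdef, cauchyV_zero]
    have hJ : pd₁ u (x, 0) ^ 2 + u (x, 0) * pd₁ v (x, 0) ^ 2 ≠ 0 := by
      rw [hux, hvx]
      intro h0
      have h4 := mul_nonneg hpos'.le (sq_nonneg (deriv vI x))
      have h5 := sq_nonneg (deriv uI x)
      have h6 : deriv vI x ^ 2 = 0 :=
        (mul_eq_zero.1 (by linarith : u (x, 0) * deriv vI x ^ 2 = 0)).resolve_left hpos'.ne'
      exact hreg x hx (by linarith)
    have c1 := h1.continuousAt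
    have c2 := (analyticAt_pd₁ h1).continuousAt
    have c3 := (analyticAt_pd₁ h2).continuousAt
    filter_upwards [h1.eventually_analyticAt, h2.eventually_analyticAt, h3,
      c1.eventually (lt_mem_nhds hpos'),
      ((c2.pow 2).add (c1.mul (c3.pow 2))).eventually_ne hJ] with p a1 a2 a3 a4 a5
    exact ⟨a1, a2, a3, a4, a5⟩
  have hGJ : ∀ p ∈ G, pd₁ u p * pd₂ v p - pd₂ u p * pd₁ v p ≠ 0 := by
    rintro p ⟨-, -, ⟨e1, e2⟩, -, hJ⟩
    have : pd₁ u p * pd₂ v p - pd₂ u p * pd₁ v p = pd₁ u p ^ 2 + u p * pd₁ v p ^ 2 := by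
      linear_combination pd₁ u p * e2 - pd₁ v p * e1
    rwa [this]
  have hinjK : InjOn (fun p => (u p, v p)) K := by
    rintro ⟨x, t⟩ ⟨hx, rfl : t = 0⟩ ⟨x', t'⟩ ⟨hx', rfl : t' = 0⟩ h
    simp only [hudef, hvdef, cauchyU_zero, cauchyV_zero] at h
    exact Prod.ext (hinj hx hx' h) rfl
  obtain ⟨S, hS, hSinj⟩ := hinjK.exists_mem_nhdsSet hKc
    (fun p hp => ((mem_of_mem_nhds (hG p hp)).1.continuousAt.prodMk
      (mem_of_mem_nhds (hG p hp)).2.1.continuousAt))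
    (fun p hp => by
      have h := mem_of_mem_nhds (hG p hp)
      exact exists_injOn_nhds (h.1.contDiffAt.prodMk h.2.1.contDiffAt)
        (injective_fderiv_prodMk h.1.differentiableAt h.2.1.differentiableAt (hGJ p h)))
  obtain ⟨δ, hδ, hbox⟩ := exists_box_subset hab
    (inter_mem hS (mem_nhdsSet_iff_forall.2 hG))
  have hbG : ∀ p ∈ box a b δ, p ∈ G := fun p hp => (hbox hp).2
  have hua : AnalyticOnNhd ℝ u (box a b δ) := fun p hp => (hbG p hp).1
  have hva : AnalyticOnNhd ℝ v (box a b δ) := fun p hp => (hbG p hp).2.1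
  have hs : IsSolution u v (box a b δ) := ⟨hua.contDiffOn (isOpen_box a b δ).uniqueDiffOn,
    hva.contDiffOn (isOpen_box a b δ).uniqueDiffOn, fun p hp => (hbG p hp).2.2.1.1,
    fun p hp => (hbG p hp).2.2.1.2⟩
  obtain ⟨Ω, f, hΩ, hΩpos, hfa, hlin, hdet⟩ := exists_hodograph_potential (isOpen_box a b δ)
    ((convex_Ioo _ _).prod (convex_Ioo _ _)) hua hva hs (fun p hp => (hbG p hp).2.2.2.1)
    (fun p hp => (hbG p hp).2.2.2.2) (hSinj.mono fun p hp => (hbox hp).1)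
  exact ⟨Ω, f, δ, u, v, hΩ, hΩpos, hfa, hlin, hδ, hua, hva, hs,
    fun x => ⟨cauchyU_zero uI vI x, cauchyV_zero uI vI x⟩, hdet⟩

theorem box_subset_box {a b δ δ' : ℝ} (h : δ ≤ δ') : box a b δ ⊆ box a b δ' :=
  prod_mono (Ioo_subset_Ioo (by linarith) (by linarith)) (Ioo_subset_Ioo (by linarith) h)

end DispersionlessNLS

open DispersionlessNLS in
theorem lemma2p1 :
    -- Solution of the Cauchy problem, along an interval `[a, b]` (possibly `a = b`).
    (∀ (a b : ℝ) (uI vI : ℝ → ℝ), a ≤ b →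
      AnalyticOnNhd ℝ uI (Set.Icc a b) → AnalyticOnNhd ℝ vI (Set.Icc a b) →
      (∀ x ∈ Set.Icc a b, 0 < uI x) →
      (∀ x ∈ Set.Icc a b, deriv uI x ^ 2 + deriv vI x ^ 2 ≠ 0) →
      Set.InjOn (fun x => (uI x, vI x)) (Set.Icc a b) →
      ∃ (Ω : Set (ℝ × ℝ)) (f : ℝ × ℝ → ℝ) (δ : ℝ) (u v : ℝ × ℝ → ℝ),
        IsOpen Ω ∧ (∀ q ∈ Ω, 0 < q.1) ∧ AnalyticOnNhd ℝ f Ω ∧ SolvesLinearPDE f Ω ∧ 0 < δ ∧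
        AnalyticOnNhd ℝ u (box a b δ) ∧ AnalyticOnNhd ℝ v (box a b δ) ∧
        IsSolution u v (box a b δ) ∧
        (∀ x ∈ Set.Ioo (a - δ) (b + δ), u (x, 0) = uI x ∧ v (x, 0) = vI x) ∧
        DeterminedByHodograph f Ω u v (box a b δ) ∧
        -- uniqueness of the analytic solution of the Cauchy problem
        (∀ (δ' : ℝ) (u' v' : ℝ × ℝ → ℝ), 0 < δ' →
          AnalyticOnNhd ℝ u' (box a b δ') → AnalyticOnNhd ℝ v' (box a b δ') →
          IsSolution u' v' (box a b δ') →
          (∀ x ∈ Set.Ioo (a - δ') (b + δ'), u' (x, 0) = uI x ∧ v' (x, 0) = vI x) →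
          Set.EqOn u' u (box a b (min δ δ')) ∧ Set.EqOn v' v (box a b (min δ δ')))) ∧
    -- The converse.
    (∀ (Ω : Set (ℝ × ℝ)) (f : ℝ × ℝ → ℝ) (u₀ v₀ : ℝ),
      IsOpen Ω → ContDiffOn ℝ 2 f Ω → SolvesLinearPDE f Ω →
      (u₀, v₀) ∈ Ω → 0 ≤ u₀ → pd₂ f (u₀, v₀) = 0 →
      u₀ ^ 2 * pd₁ (pd₁ f) (u₀, v₀) ^ 2 + pd₂ (pd₁ f) (u₀, v₀) ^ 2 ≠ 0 →
      ∃ (N : Set (ℝ × ℝ)) (δ : ℝ) (u v : ℝ × ℝ → ℝ),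
        IsOpen N ∧ N ⊆ Ω ∧ (u₀, v₀) ∈ N ∧ 0 < δ ∧
        DeterminedByHodograph f N u v (box (pd₁ f (u₀, v₀)) (pd₁ f (u₀, v₀)) δ) ∧
        u (pd₁ f (u₀, v₀), 0) = u₀ ∧ v (pd₁ f (u₀, v₀), 0) = v₀ ∧
        IsSolution u v (box (pd₁ f (u₀, v₀)) (pd₁ f (u₀, v₀)) δ) ∧
        (AnalyticOnNhd ℝ f Ω →
          AnalyticOnNhd ℝ u (box (pd₁ f (u₀, v₀)) (pd₁ f (u₀, v₀)) δ) ∧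
          AnalyticOnNhd ℝ v (box (pd₁ f (u₀, v₀)) (pd₁ f (u₀, v₀)) δ))) := by
  refine ⟨fun a b uI vI hab hu hv hpos hreg hinj => ?_,
    fun Ω f u₀ v₀ hΩ hf hlin h₀ hu₀ hfv hne =>
      exists_solution_of_hodograph hΩ hf hlin h₀ hu₀ hfv hne⟩
  obtain ⟨Ω, f, δ, u, v, hΩ, hΩpos, hfa, hlin, hδ, hua, hva, hs, hinit, hdet⟩ :=
    exists_cauchy_solution hab hu hv hpos hreg hinj
  refine ⟨Ω, f, δ, u, v, hΩ, hΩpos, hfa, hlin, hδ, hua, hva, hs, fun x _ => hinit x, hdet, ?_⟩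
  intro δ' u' v' _ hua' hva' hs' hinit'
  have h1 := box_subset_box (a := a) (b := b) (min_le_left δ δ')
  have h2 := box_subset_box (a := a) (b := b) (min_le_right δ δ')
  refine cauchy_unique (hua.mono h1) (hva.mono h1) (hua'.mono h2) (hva'.mono h2) (hs.mono h1)
    (hs'.mono h2) fun x hx => ?_
  have hx' : x ∈ Set.Ioo (a - δ') (b + δ') := by
    have := min_le_right δ δ'
    exact ⟨by linarith [hx.1], by linarith [hx.2]⟩
  rw [(hinit' x hx').1, (hinit' x hx').2, (hinit x).1, (hinit x).2]
  exact ⟨rfl, rfl⟩
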